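/- All graphs are simple, possibly infinite, and connected graphs are non-empty. A *ray* is a one-way infinite path; a graph is *rayless* if it contains no ray. An *end* of $G$ is an equivalence class of rays of $G$, where two rays are equivalent if for every finite $X\subseteq V(G)$ they have tails in the same component of $G-X$. For $X\subseteq V(G)$ let $\mathcal C_X$ be the set of components of $G-X$ and $\breve{\mathcal C}_X:=\{C\in\mathcal C_X: N(C)=X\}$. A finite set $X\subseteq V(G)$ is *critical* if $\breve{\mathcal C}_X$ is infinite. The *combinatorial remainder* $\Gamma(G)=\Omega(G)\sqcup\mathrm{crit}(G)$ is the disjoint union of the set of ends and the set of critical vertex sets of $G$. *Rank.* Finite graphs have rank $0$. For an ordinal $\rho>0$, a graph $G$ has rank $\rho$ if it has no rank $\beta<\rho$ and there is a finite $X\subseteq V(G)$ such that every component of $G-X$ has some rank $<\rho$. *Separations.* For $X\subseteq V(G)$ and $\mathcal C\subseteq\mathcal C_X$ put $V[\mathcal C]=\bigcup_{C\in\mathcal C}V(C)$, $(X,\mathcal C)=(V(G)\setminus V[\mathcal C],\,X\cup V[\mathcal C])$ and $(\mathcal C,X)=(X\cup V[\mathcal C],\,V(G)\setminus V[\mathcal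 C])$; write $(C,X)$ for $(\{C\},X)$. For finite $X$ this separation is *tame* if for no $Y\subseteq X$ both $\mathcal C$ and $\mathcal C_X\setminus\mathcal C$ contain infinitely many components with neighbourhood exactly $Y$. An end *orients* a separation $\{A,B\}$ towards $B$ if each of its rays has a tail in $B$; a critical vertex set $X$ does so if $X\subseteq B$ and all but finitely many $C\in\breve{\mathcal C}_X$ satisfy $V(C)\subseteq B$. *Tree-decompositions.* Let $(T,(V_t)_{t\in T})$ be a tree-decomposition of $G$, with $T$ rooted. For an edge $st$ of $T$ let $\alpha(s,t)=(A,B)$, where $A$ and $B$ are the unions of the parts at the nodes of the component of $T-st$ containing $s$ and $t$, respectively. The tree-decomposition is *tame* if every $\alpha(s,t)$ is a tame finite-order separation. Then each $\gamma\in\Gamma(G)$ orients every edge of $T$, and this defines a map $\sigma:\Gamma(G)\to\Omega(T)\sqcup V(T)$: put $\sigma(\gamma)=t$ if $\gamma$ orients every edge $st$ at $t$ towards $t$ (that is, orients $\alpha(s,t)=(A,B)$ towards $B$), and $\sigma(\gamma)=\eta\in\Omega(T)$ if for some ray $t_0t_1\dots$ in $\eta$ it orients every edge $t_nt_{n+1}$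 towards $t_{n+1}$. A rooted tame tree-decomposition *displays* $\Gamma(G)$ if - $\sigma$ restricts to a bijection between $\Omega(G)$ and $\Omega(T)$; and - $\sigma$ restricts to a bijection between $\mathrm{crit}(G)$ and the set of infinite-degree nodes of $T$ such that whenever $\sigma(X)=t$ for a critical vertex set $X$, then $t$ has a predecessor $s$ in the rooted tree $T$ with $\alpha(s,t)=(X,\mathcal C)$ for some $\mathcal C\subseteq\breve{\mathcal C}_X$ with $\breve{\mathcal C}_X\setminus\mathcal C$ finite, and $s'\mapsto\alpha(s',t)$ is a bijection from the neighbours of $t$ in $T$ to the set consisting of $(X,\mathcal C)$ and all $(C,X)$ with $C\in\mathcal C$. **Corollary 3.12.** Let $G$ be a connected graph. Then $G$ is rayless if and only if $G$ has a rank. If $G$ is rayless, then $G$ has a rooted tame tree-decomposition $(T,(V_t)_{t\in T})$ into finite parts that displays the combinatorial remainder $\Gamma(G)$ of $G$ and whose decomposition tree $T$ has a rank, equal to the rank of $G$. -/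

import Mathlib

universe u

namespace InfGraph

open SimpleGraph

/-! ### Rays and ends -/

/-- A ray: a one-way infinite path `v₀ v₁ v₂ …` with pairwise distinct vertices. -/
structure Ray {V : Type u} (G : SimpleGraph V) where
  vert : ℕ → V
  inj : Function.Injective vert
  adj : ∀ n, G.Adj (vert n) (vert (n + 1))

/-- A graph is rayless if it contains no ray. -/
def IsRayless {V : Type u} (G : SimpleGraph V) : Prop := IsEmpty (Ray G)

/-- The ray `R` has a tail inside the vertex set `S`. -/
def Ray.HasTailIn {V : Type u} {G : SimpleGraph V} (R : Ray G) (S : Set V) : Prop :=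
  ∃ N, ∀ n, N ≤ n → R.vert n ∈ S

/-- Two rays are equivalent if for every finite vertex set `X` both have a tail in the same
component of `G - X`. (`G.ComponentCompl X` is Mathlib's type of components of `G - X`.) -/
def Ray.Equivalent {V : Type u} {G : SimpleGraph V} (R R' : Ray G) : Prop :=
  ∀ X : Set V, X.Finite →
    ∃ C : G.ComponentCompl X, R.HasTailIn (C : Set V) ∧ R'.HasTailIn (C : Set V)

theorem Ray.exists_tail {V : Type u} {G : SimpleGraph V} (R : Ray G) {X : Set V}
    (hX : X.Finite) : ∃ C : G.ComponentCompl X, R.HasTailIn (C : Set V) := by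
  have hfin : (R.vert ⁻¹' X).Finite := hX.preimage R.inj.injOn
  obtain ⟨N, hN⟩ := hfin.bddAbove
  have hout : ∀ n, N + 1 ≤ n → R.vert n ∉ X := fun n hn h => by
    have : n ≤ N := hN h
    omega
  refine ⟨G.componentComplMk (hout (N + 1) le_rfl), N + 1, fun n hn => ?_⟩
  induction n, hn using Nat.le_induction with
  | base => exact G.componentComplMk_mem _
  | succ n hn ih =>
    exact ComponentCompl.mem_of_adj _ _ ih (hout (n + 1) (by omega)) (R.adj n)

theorem Ray.equivalent_equivalence {V : Type u} (G : SimpleGraph V) :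
    Equivalence (Ray.Equivalent (G := G)) where
  refl R X hX := by
    obtain ⟨C, hC⟩ := R.exists_tail hX
    exact ⟨C, hC, hC⟩
  symm h X hX := by
    obtain ⟨C, h1, h2⟩ := h X hX
    exact ⟨C, h2, h1⟩
  trans {R R' R''} h h' X hX := by
    obtain ⟨C, h1, N, hN⟩ := h X hX
    obtain ⟨D, ⟨M, hM⟩, h4⟩ := h' X hX
    have hCD : C = D := by
      by_contra hne
      exact (Set.disjoint_left.mp (ComponentCompl.pairwise_disjoint hne))
        (hN (max N M) (le_max_left _ _)) (hM (max N M) (le_max_right _ _))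
    subst hCD
    exact ⟨C, h1, h4⟩

/-- The setoid of rays under equivalence. -/
instance raySetoid {V : Type u} (G : SimpleGraph V) : Setoid (Ray G) :=
  ⟨Ray.Equivalent, Ray.equivalent_equivalence G⟩

/-- The ends of `G`: equivalence classes of rays. -/
def GraphEnd {V : Type u} (G : SimpleGraph V) : Type u := Quotient (raySetoid G)

/-! ### Critical vertex sets and the combinatorial remainder -/

/-- The neighbourhood of a vertex set `S`: the vertices outside `S` with a neighbour in `S`. -/
def nbhd {V : Type u} (G : SimpleGraph V) (S : Set V) : Set V :=
  {v | v ∉ S ∧ ∃ w ∈ S, G.Adj w v}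

/-- The components `C` of `G - X` with `N(C) = Y`. -/
def compsWithNbhd {V : Type u} (G : SimpleGraph V) (X Y : Set V) : Set (G.ComponentCompl X) :=
  {C | nbhd G (C : Set V) = Y}

/-- The critical vertex sets of `G`: the finite vertex sets `X` such that infinitely many
components of `G - X` have neighbourhood precisely `X`. -/
def crit {V : Type u} (G : SimpleGraph V) : Set (Set V) :=
  {X | X.Finite ∧ (compsWithNbhd G X X).Infinite}

/-- The combinatorial remainder of `G`: the disjoint union of its ends and its critical
vertex sets. -/
abbrev Remainder {V : Type u} (G : SimpleGraph V) : Type u := GraphEnd G ⊕ crit G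

/-! ### Separations -/

/-- `V[𝒞]`, the union of the vertex sets of the components in `𝒞`. -/
def compsUnion {V : Type u} {G : SimpleGraph V} {X : Set V} (𝒞 : Set (G.ComponentCompl X)) :
    Set V :=
  ⋃ C ∈ 𝒞, (C : Set V)

/-- The oriented separation `(X, 𝒞) = (V ∖ V[𝒞], X ∪ V[𝒞])`. Its inverse `(𝒞, X)` is obtained
with `Prod.swap`. -/
def orientedSep {V : Type u} {G : SimpleGraph V} (X : Set V) (𝒞 : Set (G.ComponentCompl X)) :
    Set V × Set V :=
  ((compsUnion 𝒞)ᶜ, X ∪ compsUnion 𝒞)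

/-- The pair of vertex sets `P` is a finite-order separation `{X, 𝒞}` of `G` (in one of its
orientations) that is tame: for no `Y ⊆ X` do both `𝒞` and its complement in the set of
components of `G - X` contain infinitely many components with neighbourhood precisely `Y`. -/
def IsTameSep {V : Type u} (G : SimpleGraph V) (P : Set V × Set V) : Prop :=
  ∃ (X : Set V) (𝒞 : Set (G.ComponentCompl X)), X.Finite ∧ P = orientedSep X 𝒞 ∧
    ∀ Y ⊆ X, ¬ ((𝒞 ∩ compsWithNbhd G X Y).Infinite ∧ (𝒞ᶜ ∩ compsWithNbhd G X Y).Infinite)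

/-- The element `γ` of the combinatorial remainder orients the separation `{P.1, P.2}` towards
the side `P.2`. An end does so if each of its rays has a tail in `P.2`; a critical vertex set `X`
does so if `P.2` contains `X` and all but finitely many of the components of `G - X` with
neighbourhood `X`. -/
def OrientsTowards {V : Type u} {G : SimpleGraph V} (γ : Remainder G) (P : Set V × Set V) : Prop :=
  match γ with
  | Sum.inl ω => ∀ R : Ray G, (Quotient.mk (raySetoid G) R : GraphEnd G) = ω → R.HasTailIn P.2
  | Sum.inr X => (X : Set V) ⊆ P.2 ∧
      {C ∈ compsWithNbhd G (X : Set V) (X : Set V) | ¬ (C : Set V) ⊆ P.2}.Finite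

/-! ### Tree-decompositions -/

/-- A tree-decomposition of `G` with decomposition tree on the node set `W`. -/
structure TreeDecomposition {V : Type u} (G : SimpleGraph V) (W : Type u) where
  tree : SimpleGraph W
  isTree : tree.IsTree
  part : W → Set V
  /-- Every vertex lies in some part. -/
  vertex_mem : ∀ v, ∃ t, v ∈ part t
  /-- Every edge has both its ends in some part. -/
  edge_mem : ∀ v w, G.Adj v w → ∃ t, v ∈ part t ∧ w ∈ part t
  /-- `V_{t₁} ∩ V_{t₃} ⊆ V_{t₂}` whenever `t₂` lies on the path in the tree from `t₁` to `t₃`. -/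
  inter_subset : ∀ (t₁ t₂ t₃ : W) (p : tree.Walk t₁ t₃), p.IsPath → t₂ ∈ p.support →
    part t₁ ∩ part t₃ ⊆ part t₂

namespace TreeDecomposition

variable {V : Type u} {G : SimpleGraph V} {W : Type u} (D : TreeDecomposition G W)

/-- For an edge `st` of the tree: the nodes of the component of `T - st` containing `s`. -/
def side (s t : W) : Set W := {x | (D.tree.deleteEdges {s(s, t)}).Reachable s x}

/-- For an edge `st` of the tree: the oriented separation `α(s, t)` of `G` that it induces, i.e.
the pair of the union of the parts on the side of `s` and the union of the parts on the side
of `t`. -/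
def sep (s t : W) : Set V × Set V :=
  (⋃ x ∈ D.side s t, D.part x, ⋃ x ∈ D.side t s, D.part x)

/-- A tree-decomposition is tame if all the separations that it induces are tame finite-order
separations. -/
def IsTame : Prop := ∀ s t, D.tree.Adj s t → IsTameSep G (D.sep s t)

/-- `γ` lives at the node `t`: it orients all the edges of the tree at `t` towards `t`. -/
def LivesAt (γ : Remainder G) (t : W) : Prop :=
  ∀ s, D.tree.Adj s t → OrientsTowards γ (D.sep s t)

/-- `γ` corresponds to the end `η` of the tree: for some ray `t₀ t₁ …` in `η`, it orients all the
edges `tₙ tₙ₊₁` from `tₙ` towards `tₙ₊₁`. -/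
def CorrespondsTo (γ : Remainder G) (η : GraphEnd D.tree) : Prop :=
  ∃ R : Ray D.tree, (Quotient.mk (raySetoid D.tree) R : GraphEnd D.tree) = η ∧
    ∀ n, OrientsTowards γ (D.sep (R.vert n) (R.vert (n + 1)))

/-- `σ` is the map from the combinatorial remainder of `G` to the disjoint union of the ends
and the nodes of the tree that sends each `γ` to the unique end or node that it corresponds to
or lives at, respectively. -/
def IsSigma (σ : Remainder G → GraphEnd D.tree ⊕ W) : Prop :=
  ∀ γ, (∀ η, σ γ = Sum.inl η ↔ D.CorrespondsTo γ η) ∧ (∀ t, σ γ = Sum.inr t ↔ D.LivesAt γ t)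

/-- In the tree rooted at `r`, the node `s` is the predecessor of `t`: they are adjacent and `s`
lies on the path from `r` to `t`. -/
def IsPredecessor (r s t : W) : Prop :=
  D.tree.Adj s t ∧ ∀ p : D.tree.Walk r t, p.IsPath → s ∈ p.support

/-- The tree-decomposition `D`, with its tree rooted at `r`, displays the subset `Ψ` of the
combinatorial remainder of `G`. (Meant for tame `D`.) The oriented edges `(s, t)` of the tree
into a node `t` are indexed by the neighbours `s` of `t`. -/
def Displays (r : W) (Ψ : Set (Remainder G)) : Prop :=
  ∃ σ : Remainder G → GraphEnd D.tree ⊕ W, D.IsSigma σ ∧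
    Set.BijOn σ (Ψ ∩ Set.range Sum.inl) (Set.range Sum.inl) ∧
    Set.BijOn σ (Ψ ∩ Set.range Sum.inr) (Sum.inr '' {t | (D.tree.neighborSet t).Infinite}) ∧
    (∀ (X : crit G) (t : W), Sum.inr X ∈ Ψ → σ (Sum.inr X) = Sum.inr t →
      ∃ (s : W) (𝒞 : Set (G.ComponentCompl (X : Set V))), D.IsPredecessor r s t ∧
        D.sep s t = orientedSep (X : Set V) 𝒞 ∧
        𝒞 ⊆ compsWithNbhd G (X : Set V) (X : Set V) ∧
        (compsWithNbhd G (X : Set V) (X : Set V) \ 𝒞).Finite ∧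
        Set.BijOn (fun s' => D.sep s' t) (D.tree.neighborSet t)
          (insert (orientedSep (X : Set V) 𝒞)
            {P | ∃ C ∈ 𝒞, P = (orientedSep (X : Set V) {C}).swap})) ∧
    ∀ γ, γ ∉ Ψ → ∃ t, σ γ = Sum.inr t ∧ (D.tree.neighborSet t).Finite

end TreeDecomposition

/-! ### The Schmidt rank -/

/-- `HasRank ρ G`: the graph `G` has (Schmidt) rank `ρ`. Finite graphs have rank `0`; for `ρ > 0`
the graph `G` has rank `ρ` if it does not already have a rank `< ρ` and there is a finite set `X`
of vertices such that every component of `G - X` has some rank `< ρ`. -/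
def HasRank (ρ : Ordinal.{u}) {V : Type u} (G : SimpleGraph V) : Prop :=
  (ρ = 0 ∧ Finite V) ∨
  (0 < ρ ∧ (∀ β, ∀ _ : β < ρ, ¬ HasRank β G) ∧
    ∃ X : Set V, X.Finite ∧ ∀ C : G.ComponentCompl X,
      ∃ β, ∃ _ : β < ρ, HasRank β (G.induce (C : Set V)))
termination_by ρ

end InfGraph

/-! A graph with a rank has no ray: a ray would have a tail in a component of smaller rank.
Conversely, if a connected graph has no rank, then after any finite deletion some component still
has none, as otherwise the successor of the supremum of the ranks would do. Deleting the current
vertex, passing to such a component and stepping to a neighbour in it builds a ray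
(`IsRayless.exists_rankLE`).

For the decomposition, choose in every connected set `C` a finite nonempty `X C ⊆ C` such that all
components of `C ∖ X C` have smaller rank. Iterating from the whole graph yields nested branches,
and each vertex is deleted at a finite level because ordinals are well-founded. The part of a branch
`C` is the finite set `X C ∪ N(C)`. A branch may have infinitely many successors, but their
neighbourhoods lie in its finite part, so infinitely many of them then share a neighbourhood `Y`,
which is critical. A node with part `Y` is inserted between the branch and all successors with
neighbourhood `Y`. Branches then have finite degree.

Every critical `Y` arises in this way: for a vertex of `Y` of maximal height with last branch `C`,
the set `Y` lies in the part of `C` (`crit_subset`), and all but finitely many components with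
neighbourhood `Y` are branches one level further down (`finite_comps_notMem_range`). Hence the nodes
of infinite degree are precisely the critical sets. Neither the graph nor the tree has ends.

The rank of the tree is at most that of the graph: below a branch `C`, delete `C` and its finitely
many critical children, and what remains splits along components of `C ∖ X C` (`rankLE_below`). The
converse inequality holds for every decomposition into finite parts (`RankLE.of_decomposition`). -/

namespace InfGraph

open SimpleGraph

/-! ### Connected vertex sets and components of vertex sets -/

section Components

variable {V : Type u} {G : SimpleGraph V}

/-- `D` is a nonempty vertex set inducing a connected subgraph: a set that meets `D` and is closed
under passing to neighbours within `D` contains `D`. -/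
def ConnSet (G : SimpleGraph V) (D : Set V) : Prop :=
  D.Nonempty ∧ ∀ A : Set V, (D ∩ A).Nonempty →
    (∀ a ∈ A, a ∈ D → ∀ b ∈ D, G.Adj a b → b ∈ A) → D ⊆ A

/-- `D` is the vertex set of a component of `G[S]`. -/
structure IsComp (G : SimpleGraph V) (S D : Set V) : Prop where
  conn : ConnSet G D
  sub : D ⊆ S
  closed : ∀ a ∈ D, ∀ b ∈ S, G.Adj a b → b ∈ D

/-- The vertex set of the component of `G[S]` that contains `v`; empty if `v ∉ S`. -/
def compOf (G : SimpleGraph V) (S : Set V) (v : V) : Set V :=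
  {w | v ∈ S ∧ Relation.ReflTransGen (fun a b => G.Adj a b ∧ a ∈ S ∧ b ∈ S) v w}

theorem mem_of_reachable {A : Set V} (hA : ∀ a ∈ A, ∀ b, G.Adj a b → b ∈ A) {a b : V}
    (h : G.Reachable a b) (ha : a ∈ A) : b ∈ A := by
  obtain ⟨p⟩ := h
  induction p with
  | nil => exact ha
  | cons h p ih => exact ih (hA _ ha _ h)

theorem compOf_subset (S : Set V) (v : V) : compOf G S v ⊆ S := by
  rintro w ⟨hv, h⟩
  induction h with
  | refl => exact hv
  | tail _ h _ => exact h.2.2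

theorem mem_compOf {S : Set V} {v : V} (hv : v ∈ S) : v ∈ compOf G S v := ⟨hv, .refl⟩

theorem isComp_compOf {S : Set V} {v : V} (hv : v ∈ S) : IsComp G S (compOf G S v) where
  sub := compOf_subset S v
  closed a ha b hb hab := ⟨hv, ha.2.tail ⟨hab, compOf_subset S v ha, hb⟩⟩
  conn := by
    refine ⟨⟨v, mem_compOf hv⟩, fun A ⟨a, ha, haA⟩ hA => ?_⟩
    -- `A` is only known to contain some `a` of the component, so the chain is followed back to `v`
    -- before it is followed forward.
    have hvA : v ∈ A := by
      obtain ⟨-, h⟩ := ha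
      induction h with
      | refl => exact haA
      | tail h1 h2 ih => exact ih (hA _ haA ⟨hv, h1.tail h2⟩ _ ⟨hv, h1⟩ h2.1.symm)
    rintro w ⟨-, hw⟩
    induction hw with
    | refl => exact hvA
    | tail h1 h2 ih =>
      exact hA _ ih ⟨hv, h1⟩ _ ⟨hv, h1.tail h2⟩ h2.1

theorem ConnSet.subset_of_isComp {S D K : Set V} (hK : ConnSet G K) (hD : IsComp G S D)
    (hKS : K ⊆ S) (h : (K ∩ D).Nonempty) : K ⊆ D :=
  hK.2 D h fun a ha _ b hb hab => hD.closed a ha b (hKS hb) hab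

theorem IsComp.eq {S D D' : Set V} (hD : IsComp G S D) (hD' : IsComp G S D')
    (h : (D ∩ D').Nonempty) : D = D' :=
  (hD.conn.subset_of_isComp hD' hD.sub h).antisymm
    (hD'.conn.subset_of_isComp hD hD'.sub (Set.inter_comm D D' ▸ h))

theorem IsComp.eq_compOf {S D : Set V} (hD : IsComp G S D) {v : V} (hv : v ∈ D) :
    D = compOf G S v :=
  hD.eq (isComp_compOf (hD.sub hv)) ⟨v, hv, mem_compOf (hD.sub hv)⟩

theorem ConnSet.isComp_compl_nbhd {D : Set V} (hD : ConnSet G D) :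
    IsComp G (nbhd G D)ᶜ D where
  conn := hD
  sub := fun _ ha h => h.1 ha
  closed a ha b hb hab := by
    by_contra h
    exact hb ⟨h, a, ha, hab⟩

theorem ConnSet.subset_of_disjoint_nbhd {K D : Set V} (hK : ConnSet G K)
    (h : (K ∩ D).Nonempty) (hd : ∀ v ∈ K, v ∉ nbhd G D) : K ⊆ D :=
  hK.2 D h fun a ha _ b hb hab => by
    by_contra hbD
    exact hd b hb ⟨hbD, a, ha, hab⟩

theorem connSet_univ (hG : G.Connected) : ConnSet G Set.univ := by
  obtain ⟨v⟩ := hG.nonempty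
  refine ⟨⟨v, trivial⟩, fun A ⟨a, _, ha⟩ hA w _ => ?_⟩
  exact mem_of_reachable (fun a ha b hab => hA a ha trivial b trivial hab) (hG.preconnected a w) ha

theorem ConnSet.image {V' : Type u} {H : SimpleGraph V'} (f : H →g G) {D : Set V'}
    (hD : ConnSet H D) : ConnSet G (f '' D) := by
  refine ⟨hD.1.image f, fun A ⟨_, ⟨a, ha, rfl⟩, haA⟩ hA => ?_⟩
  rw [Set.image_subset_iff]
  exact hD.2 _ ⟨a, ha, haA⟩ fun a ha haD b hb hab =>
    hA _ ha ⟨a, haD, rfl⟩ _ ⟨b, hb, rfl⟩ (f.map_adj hab)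

theorem ConnSet.preconnected {D : Set V} (hD : ConnSet G D) : (G.induce D).Preconnected := by
  intro a b
  have := hD.2 {w | ∃ h : w ∈ D, (G.induce D).Reachable a ⟨w, h⟩} ⟨a, a.2, a.2, .refl _⟩
    (by
      rintro x ⟨_, hx⟩ hxD y hy hxy
      exact ⟨hy, hx.trans (Adj.reachable (by simpa using hxy))⟩) b.2
  exact this.2

theorem isComp_componentCompl {X : Set V} (C : G.ComponentCompl X) : IsComp G Xᶜ (C : Set V) where
  sub _ hv := ComponentCompl.notMem_of_mem hv
  closed a ha b hb hab := ComponentCompl.mem_of_adj a b ha hb hab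
  conn := by
    refine ⟨C.nonempty, fun A ⟨a, ha, haA⟩ hA => ?_⟩
    rintro w hw
    obtain ⟨ha', ha''⟩ := ha
    obtain ⟨hw', hw''⟩ := hw
    have hr : (G.induce Xᶜ).Reachable ⟨a, ha'⟩ ⟨w, hw'⟩ :=
      ConnectedComponent.exact (ha''.trans hw''.symm)
    have := mem_of_reachable (A := {x : (Xᶜ : Set V) | (x : V) ∈ A ∧ (x : V) ∈ C}) ?_ hr ⟨haA, ⟨ha', ha''⟩⟩
    · exact this.1
    · rintro x ⟨hx, hxC⟩ y hxy
      have hxy' : G.Adj x y := by simpa using hxy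
      have hyC := ComponentCompl.mem_of_adj (x : V) y hxC y.2 hxy'
      exact ⟨hA _ hx hxC _ hyC hxy', hyC⟩

theorem IsComp.exists_componentCompl {X D : Set V} (hD : IsComp G Xᶜ D) :
    ∃ C : G.ComponentCompl X, (C : Set V) = D := by
  obtain ⟨v, hv⟩ := hD.conn.1
  have hvX : v ∉ X := hD.sub hv
  exact ⟨G.componentComplMk hvX, (isComp_componentCompl _).eq hD ⟨v, G.componentComplMk_mem hvX, hv⟩⟩

theorem ConnSet.isComp_of_nbhd {D X : Set V} (hD : ConnSet G D) (h : nbhd G D = X) :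
    IsComp G Xᶜ D := h ▸ hD.isComp_compl_nbhd

/-- Only finitely many components of `G - X` meet a given finite set. -/
theorem finite_componentCompl_meeting {X Z : Set V} (hZ : Z.Finite) :
    {C : G.ComponentCompl X | ((C : Set V) ∩ Z).Nonempty}.Finite := by
  classical
  have : {C : G.ComponentCompl X | ((C : Set V) ∩ Z).Nonempty} ⊆
      ⋃ z ∈ Z, {C : G.ComponentCompl X | z ∈ (C : Set V)} := by
    rintro C ⟨z, hz, hzZ⟩
    exact Set.mem_biUnion hzZ hz
  refine (hZ.biUnion fun z _ => Set.Subsingleton.finite ?_).subset this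
  intro C hC D hD
  by_contra hne
  exact Set.disjoint_left.mp (ComponentCompl.pairwise_disjoint hne) hC hD

end Components

/-! ### The rank -/

section Rank

variable {V : Type u} {G : SimpleGraph V}

/-- `G` has a rank that is at most `ρ`. -/
def RankLE (ρ : Ordinal.{u}) {V : Type u} (G : SimpleGraph V) : Prop := ∃ β ≤ ρ, HasRank β G

theorem RankLE.mono {ρ σ : Ordinal.{u}} (h : RankLE ρ G) (hσ : ρ ≤ σ) : RankLE σ G := by
  obtain ⟨β, hβ, h⟩ := h
  exact ⟨β, hβ.trans hσ, h⟩

theorem HasRank.not_lt {ρ σ : Ordinal.{u}} (h : HasRank ρ G) (h' : HasRank σ G) : ¬ ρ < σ := by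
  intro hlt
  rw [HasRank] at h'
  rcases h' with ⟨rfl, -⟩ | ⟨-, h', -⟩
  · exact not_lt_zero hlt
  · exact h' ρ hlt h

theorem HasRank.unique {ρ σ : Ordinal.{u}} (h : HasRank ρ G) (h' : HasRank σ G) : ρ = σ :=
  le_antisymm (_root_.not_lt.mp (h'.not_lt h)) (_root_.not_lt.mp (h.not_lt h'))

/-- Passing to "rank at most `ρ`" removes the minimality clause of `HasRank` and merges its two
cases: for `ρ = 0` no component can remain, so `X` is the whole vertex set. -/
theorem rankLE_iff_componentCompl {ρ : Ordinal.{u}} : RankLE ρ G ↔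
    ∃ X : Set V, X.Finite ∧ ∀ C : G.ComponentCompl X,
      ∃ β < ρ, RankLE β (G.induce (C : Set V)) := by
  constructor
  · rintro ⟨β, hβ, h⟩
    rw [HasRank] at h
    rcases h with ⟨rfl, h⟩ | ⟨-, -, X, hX, h⟩
    · refine ⟨Set.univ, Set.finite_univ, fun C => ?_⟩
      obtain ⟨v, hv⟩ := C.nonempty
      exact absurd trivial (ComponentCompl.notMem_of_mem hv)
    · refine ⟨X, hX, fun C => ?_⟩
      obtain ⟨γ, hγ, h⟩ := h C
      exact ⟨γ, hγ.trans_le hβ, γ, le_rfl, h⟩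
  · rintro ⟨X, hX, h⟩
    by_cases hlt : ∃ β < ρ, HasRank β G
    · obtain ⟨β, hβ, h⟩ := hlt
      exact ⟨β, hβ.le, h⟩
    push Not at hlt
    refine ⟨ρ, le_rfl, ?_⟩
    rw [HasRank]
    rcases eq_or_ne ρ 0 with rfl | hρ
    · refine Or.inl ⟨rfl, ?_⟩
      rw [← Set.finite_univ_iff]
      refine hX.subset fun v _ => ?_
      by_contra hv
      obtain ⟨β, hβ, -⟩ := h (G.componentComplMk hv)
      exact not_lt_zero hβ
    · refine Or.inr ⟨pos_iff_ne_zero.mpr hρ, fun β hβ => hlt β hβ, X, hX, fun C => ?_⟩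
      obtain ⟨β, hβ, γ, hγ, h⟩ := h C
      exact ⟨γ, hγ.trans_lt hβ, h⟩

theorem rankLE_iff_isComp {ρ : Ordinal.{u}} : RankLE ρ G ↔
    ∃ X : Set V, X.Finite ∧ ∀ D, IsComp G Xᶜ D → ∃ β < ρ, RankLE β (G.induce D) := by
  rw [rankLE_iff_componentCompl]
  refine exists_congr fun X => and_congr_right fun _ => ⟨fun h D hD => ?_, fun h C => h _ ?_⟩
  · obtain ⟨C, rfl⟩ := hD.exists_componentCompl
    exact h C
  · exact isComp_componentCompl C

/-- The preimage of the deleted set is finite, and each component of what remains of `H` maps into a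
single component of what remains of `G`. -/
theorem RankLE.of_hom {ρ : Ordinal.{u}} {V' : Type u} {H : SimpleGraph V'} (f : H →g G)
    (hf : Function.Injective f) (h : RankLE ρ G) : RankLE ρ H := by
  induction ρ using WellFoundedLT.induction generalizing V V' with
  | ind ρ ih =>
    rw [rankLE_iff_isComp] at h ⊢
    obtain ⟨X, hX, h⟩ := h
    refine ⟨f ⁻¹' X, hX.preimage hf.injOn, fun D hD => ?_⟩
    obtain ⟨v, hv⟩ := hD.conn.1
    have hDX : f '' D ⊆ Xᶜ := by
      rintro _ ⟨w, hw, rfl⟩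
      exact hD.sub hw
    have hvX : f v ∈ Xᶜ := hDX ⟨v, hv, rfl⟩
    obtain ⟨β, hβ, hr⟩ := h _ (isComp_compOf hvX)
    have hsub := (hD.conn.image f).subset_of_isComp (isComp_compOf (G := G) hvX) hDX
      ⟨f v, ⟨v, hv, rfl⟩, mem_compOf hvX⟩
    refine ⟨β, hβ, ih β hβ (V' := D) ⟨fun x => ⟨f x, hsub ⟨x, x.2, rfl⟩⟩, ?_⟩ ?_ hr⟩
    · intro a b hab
      have hab' : H.Adj a b := by simpa using hab
      simpa using f.map_adj hab'
    · intro a b hab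
      exact Subtype.ext (hf (congrArg Subtype.val hab))

theorem RankLE.induce_mono {ρ : Ordinal.{u}} {S S' : Set V} (hS : S ⊆ S')
    (h : RankLE ρ (G.induce S')) : RankLE ρ (G.induce S) :=
  h.of_hom (G.induceHomOfLE hS).toHom (G.induceHomOfLE hS).injective

theorem rankLE_induce_univ {ρ : Ordinal.{u}} : RankLE ρ (G.induce Set.univ) ↔ RankLE ρ G := by
  refine ⟨fun h => ?_, fun h => ?_⟩
  · exact h.of_hom (G.induceUnivIso.symm.toHom) G.induceUnivIso.symm.injective
  · exact h.of_hom (G.induceUnivIso.toHom) G.induceUnivIso.injective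

/-- This form keeps all sets inside `V`, so that repeated deletions do not produce nested subtypes.
-/
theorem rankLE_induce_iff {ρ : Ordinal.{u}} {S : Set V} : RankLE ρ (G.induce S) ↔
    ∃ X : Set V, X.Finite ∧ ∀ D, IsComp G (S \ X) D → ∃ β < ρ, RankLE β (G.induce D) := by
  rw [rankLE_iff_isComp]
  constructor
  · rintro ⟨X, hX, h⟩
    refine ⟨(↑) '' X, hX.image _, fun D hD => ?_⟩
    have hDS : ∀ w ∈ D, ∃ h : w ∈ S, (⟨w, h⟩ : S) ∈ Xᶜ := fun w hw =>
      ⟨(hD.sub hw).1, fun h => (hD.sub hw).2 ⟨_, h, rfl⟩⟩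
    obtain ⟨v, hv⟩ := hD.conn.1
    obtain ⟨hvS, hvX⟩ := hDS v hv
    obtain ⟨β, hβ, hr⟩ := h _ (isComp_compOf hvX)
    have hsub : D ⊆ {w | ∃ h : w ∈ S, (⟨w, h⟩ : S) ∈ compOf (G.induce S) Xᶜ ⟨v, hvS⟩} := by
      refine hD.conn.2 _ ⟨v, hv, hvS, mem_compOf hvX⟩ ?_
      rintro a ⟨haS, ha⟩ haD b hb hab
      obtain ⟨hbS, hbX⟩ := hDS b hb
      exact ⟨hbS, (isComp_compOf hvX).closed _ ha _ hbX (by simpa using hab)⟩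
    refine ⟨β, hβ, hr.of_hom ⟨fun x => ⟨⟨x, (hsub x.2).1⟩, (hsub x.2).2⟩, ?_⟩ ?_⟩
    · intro a b hab
      simpa using hab
    · intro a b hab
      have hab' := congrArg Subtype.val (congrArg Subtype.val hab)
      exact Subtype.ext hab'
  · rintro ⟨X, hX, h⟩
    refine ⟨(↑) ⁻¹' X, hX.preimage Subtype.val_injective.injOn, fun D hD => ?_⟩
    have hsub : (↑) '' D ⊆ S \ X := by
      rintro _ ⟨w, hw, rfl⟩
      exact ⟨w.2, hD.sub hw⟩
    obtain ⟨v, hv⟩ := hD.conn.1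
    have hvX : (v : V) ∈ S \ X := hsub ⟨v, hv, rfl⟩
    obtain ⟨β, hβ, hr⟩ := h _ (isComp_compOf hvX)
    have hsub' := (hD.conn.image (Embedding.induce (G := G) S).toHom).subset_of_isComp
      (isComp_compOf hvX) hsub ⟨v, ⟨v, hv, rfl⟩, mem_compOf hvX⟩
    refine ⟨β, hβ, hr.of_hom ⟨fun x => ⟨x, hsub' ⟨x, x.2, rfl⟩⟩, ?_⟩ ?_⟩
    · intro a b hab
      simpa using hab
    · intro a b hab
      have hab' := congrArg Subtype.val hab
      exact Subtype.ext (Subtype.ext hab')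

/-! ### Rayless graphs are the graphs with a rank -/

theorem RankLE.isRayless {ρ : Ordinal.{u}} (h : RankLE ρ G) : IsRayless G := by
  induction ρ using WellFoundedLT.induction generalizing V with
  | ind ρ ih =>
    rw [rankLE_iff_componentCompl] at h
    obtain ⟨X, hX, h⟩ := h
    refine ⟨fun R => ?_⟩
    obtain ⟨C, N, hN⟩ := R.exists_tail hX
    obtain ⟨β, hβ, hr⟩ := h C
    refine (ih β hβ hr).false ⟨fun n => ⟨R.vert (N + n), hN _ (by omega)⟩, ?_, ?_⟩
    · intro a b hab
      have := R.inj (congrArg Subtype.val hab)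
      omega
    · intro n
      exact R.adj (N + n)

/-- If `G[S]` has no rank, then neither has some component of `G[S ∖ X]`, for `X` finite. -/
theorem exists_isComp_unranked {S X : Set V} (hX : X.Finite)
    (hS : ¬ ∃ ρ, RankLE ρ (G.induce S)) :
    ∃ D, IsComp G (S \ X) D ∧ ¬ ∃ ρ, RankLE ρ (G.induce D) := by
  by_contra! hcon
  choose! f hf using hcon
  -- The supremum runs over all subsets of `V`; arbitrary values of `f` on sets that are not
  -- components do no harm.
  refine hS ⟨Order.succ (⨆ D : Set V, f D), rankLE_induce_iff.mpr ⟨X, hX, fun D hD => ?_⟩⟩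
  exact ⟨f D, Order.lt_succ_of_le (Ordinal.le_iSup f D), hf D hD⟩

theorem IsRayless.exists_rankLE (hG : G.Connected) (h : IsRayless G) :
    ∃ ρ, RankLE ρ G := by
  by_contra hcon
  -- a state is a connected set without rank, together with one of its vertices
  let St := {p : Set V × V // p.2 ∈ p.1 ∧ ConnSet G p.1 ∧ ¬ ∃ ρ, RankLE ρ (G.induce p.1)}
  have step : ∀ p : St, ∃ q : St, q.1.1 ⊆ p.1.1 \ {p.1.2} ∧ G.Adj p.1.2 q.1.2 := by
    rintro ⟨⟨S, v⟩, hv, hS, hr⟩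
    obtain ⟨D, hD, hDr⟩ := exists_isComp_unranked (Set.finite_singleton v) hr
    -- Without a neighbour of `v`, the component `D` of `S ∖ {v}` would be closed under adjacency in
    -- the connected set `S`, hence contain `v`.
    have : ∃ w ∈ D, G.Adj v w := by
      by_contra! hno
      obtain ⟨d, hd⟩ := hD.conn.1
      have := hS.2 D ⟨d, (hD.sub hd).1, hd⟩ fun a ha _ b hb hab =>
        hD.closed a ha b ⟨hb, fun hbv => hno a ha (by
          rw [Set.mem_singleton_iff] at hbv; exact hbv ▸ hab.symm)⟩ hab
      exact (hD.sub (this hv)).2 rfl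
    obtain ⟨w, hw, hvw⟩ := this
    exact ⟨⟨⟨D, w⟩, hw, hD.conn, hDr⟩, hD.sub, hvw⟩
  choose next hnext hadj using step
  obtain ⟨v₀⟩ := hG.nonempty
  let st : ℕ → St := fun n => next^[n] ⟨⟨Set.univ, v₀⟩, trivial, connSet_univ hG,
    fun ⟨ρ, hρ⟩ => hcon ⟨ρ, rankLE_induce_univ.mp hρ⟩⟩
  have hst : ∀ n, st (n + 1) = next (st n) := fun n => Function.iterate_succ_apply' _ _ _
  have hanti : Antitone fun n => (st n).1.1 := antitone_nat_of_succ_le fun n => by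
    rw [hst]
    exact (hnext _).trans Set.sdiff_subset
  have hne : ∀ m n, m < n → (st m).1.2 ≠ (st n).1.2 := by
    intro m n hmn heq
    have h1 : (st n).1.2 ∈ (st (m + 1)).1.1 := hanti (Nat.succ_le_of_lt hmn) (st n).2.1
    rw [hst, ← heq] at h1
    exact (hnext _ h1).2 rfl
  refine h.false ⟨fun n => (st n).1.2, fun m n hmn => ?_, fun n => ?_⟩
  · by_contra hne'
    rcases Nat.lt_or_gt_of_ne hne' with hlt | hlt
    · exact hne m n hlt hmn
    · exact hne n m hlt hmn.symm
  · show G.Adj (st n).1.2 (st (n + 1)).1.2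
    rw [hst]
    exact hadj _

/-! ### Decompositions into finite parts -/

/-- A graph decomposed into finite parts modelled on a graph of rank at most `ρ` has rank
at most `ρ`. -/
theorem RankLE.of_decomposition {ρ : Ordinal.{u}} {W : Type u} {T : SimpleGraph W}
    (part : W → Set V) (hfin : ∀ t, (part t).Finite)
    (hconn : ∀ v, ConnSet T {t | v ∈ part t})
    (hedge : ∀ v w, G.Adj v w → ∃ t, v ∈ part t ∧ w ∈ part t) {S : Set W} {A : Set V}
    (hA : ∀ v ∈ A, {t | v ∈ part t} ⊆ S)
    (h : RankLE ρ (T.induce S)) : RankLE ρ (G.induce A) := by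
  induction ρ using WellFoundedLT.induction generalizing S A with
  | ind ρ ih =>
    rw [rankLE_induce_iff] at h ⊢
    obtain ⟨X, hX, h⟩ := h
    refine ⟨⋃ t ∈ X, part t, hX.biUnion fun t _ => hfin t, fun D hD => ?_⟩
    have hDS : ∀ v ∈ D, {t | v ∈ part t} ⊆ S \ X := fun v hv t ht =>
      ⟨hA v (hD.sub hv).1 ht, fun htX => (hD.sub hv).2 (Set.mem_biUnion htX ht)⟩
    obtain ⟨v, hv⟩ := hD.conn.1
    obtain ⟨t, ht⟩ := (hconn v).1
    have htS := hDS v hv ht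
    have hK := isComp_compOf (G := T) htS
    obtain ⟨β, hβ, hr⟩ := h _ hK
    refine ⟨β, hβ, ih β hβ (fun w hw => ?_) hr⟩
    -- The nodes of a vertex of `D` avoid `X`, so they lie in one component of `T[S ∖ X]`; adjacent
    -- vertices share a node, hence also this component.
    refine hD.conn.2 {w | {t | w ∈ part t} ⊆ compOf T (S \ X) t} ⟨v, hv, ?_⟩ ?_ hw
    · exact (hconn v).subset_of_isComp hK (hDS v hv) ⟨t, ht, mem_compOf htS⟩
    · intro a ha haD b hb hab
      obtain ⟨s, hsa, hsb⟩ := hedge a b hab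
      exact (hconn b).subset_of_isComp hK (hDS b hb) ⟨s, hsb, ha hsa⟩

end Rank

/-! ### Rooted trees given by a parent function -/

section ParentFunction

variable {W : Type u}

/-- The graph in which every node is joined to its parent. -/
def parentGraph (p : W → W) : SimpleGraph W := SimpleGraph.fromRel fun a b => p a = b

/-- `b` is a descendant of `a` (possibly `a` itself). -/
def Desc (p : W → W) (a b : W) : Prop := ∃ n, p^[n] b = a

theorem Desc.refl (p : W → W) (a : W) : Desc p a a := ⟨0, rfl⟩

theorem Desc.trans {p : W → W} {a b c : W} (h : Desc p a b) (h' : Desc p b c) : Desc p a c := by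
  obtain ⟨m, rfl⟩ := h
  obtain ⟨n, rfl⟩ := h'
  exact ⟨m + n, Function.iterate_add_apply _ _ _ _⟩

theorem desc_parent (p : W → W) (a : W) : Desc p (p a) a := ⟨1, rfl⟩

theorem Desc.parent {p : W → W} {a b : W} (h : Desc p a b) (hne : b ≠ a) : Desc p a (p b) := by
  obtain ⟨n, hn⟩ := h
  cases n with
  | zero => exact absurd hn hne
  | succ n => exact ⟨n, hn⟩

theorem Desc.total {p : W → W} {a b c : W} (h : Desc p a c) (h' : Desc p b c) :
    Desc p a b ∨ Desc p b a := by
  obtain ⟨m, rfl⟩ := h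
  obtain ⟨n, rfl⟩ := h'
  rcases le_total m n with hmn | hmn
  · refine Or.inr ⟨n - m, ?_⟩
    rw [← Function.iterate_add_apply, Nat.sub_add_cancel hmn]
  · refine Or.inl ⟨m - n, ?_⟩
    rw [← Function.iterate_add_apply, Nat.sub_add_cancel hmn]

theorem Desc.exists_child {p : W → W} {a b : W} (h : Desc p a b) (hne : a ≠ b) :
    ∃ c, p c = a ∧ c ≠ a ∧ Desc p c b := by
  obtain ⟨n, hn⟩ := h
  induction n generalizing b with
  | zero => exact absurd hn.symm hne
  | succ n ih =>
    by_cases hpb : a = p b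
    · exact ⟨b, hpb.symm, hne.symm, .refl p b⟩
    · obtain ⟨c, hc, hca, hcb⟩ := ih hpb hn
      exact ⟨c, hc, hca, hcb.trans (desc_parent p b)⟩

/-- `p` is a parent function on `W` with root `r`, as witnessed by the height function `d`. -/
structure IsParentFun (p : W → W) (r : W) (d : W → ℕ) : Prop where
  root : p r = r
  lt : ∀ a, a ≠ r → d (p a) < d a

namespace IsParentFun

variable {p : W → W} {r : W} {d : W → ℕ} (h : IsParentFun p r d)
include h

theorem parent_ne {a : W} (ha : a ≠ r) : p a ≠ a := fun he => (h.lt a ha).ne (by rw [he])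

theorem desc_root (a : W) : Desc p r a := by
  induction hn : d a using Nat.strong_induction_on generalizing a with
  | _ n ih =>
    by_cases ha : a = r
    · exact ha ▸ .refl p a
    · exact (ih _ (hn ▸ h.lt a ha) _ rfl).trans (desc_parent p a)

theorem eq_root_of_desc {a : W} (ha : Desc p a r) : a = r := by
  obtain ⟨n, rfl⟩ := ha
  exact Function.iterate_fixed h.root n

theorem le_of_desc {a b : W} (hab : Desc p a b) : d a ≤ d b := by
  obtain ⟨n, hn⟩ := hab
  induction n generalizing b with
  | zero => exact hn ▸ le_rfl
  | succ n ih =>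
    refine (ih hn).trans ?_
    by_cases hb : b = r
    · rw [hb, h.root]
    · exact (h.lt b hb).le

theorem desc_antisymm {a b : W} (hab : Desc p a b) (hba : Desc p b a) : a = b := by
  by_contra hne
  have hb : b ≠ r := fun hb => hne (by rw [hb] at hab ⊢; exact h.eq_root_of_desc hab)
  have h1 := h.le_of_desc (hab.parent (Ne.symm hne))
  have h2 := h.le_of_desc hba
  have h3 := h.lt b hb
  omega

theorem not_desc_parent {a : W} (ha : a ≠ r) : ¬ Desc p a (p a) := fun hd =>
  h.parent_ne ha (h.desc_antisymm (desc_parent p a) hd)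

theorem adj_parent {a : W} (ha : a ≠ r) : (parentGraph p).Adj (p a) a :=
  ⟨h.parent_ne ha, Or.inr rfl⟩

theorem adj_cases {s t : W} (hst : (parentGraph p).Adj s t) :
    (s ≠ r ∧ p s = t) ∨ (t ≠ r ∧ p t = s) := by
  obtain ⟨hne, hs | ht⟩ := hst
  · exact Or.inl ⟨fun hr => hne (by rw [← hs, hr, h.root]), hs⟩
  · exact Or.inr ⟨fun hr => hne (by rw [← ht, hr, h.root]), ht⟩

/-- The edge from `a` to its parent is the only edge leaving the set of descendants of `a`. Together
with `reachable_above_iff` this computes the two sides of a tree edge. -/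
theorem reachable_below_iff {a : W} (ha : a ≠ r) (x : W) :
    ((parentGraph p).deleteEdges {s(a, p a)}).Reachable a x ↔ Desc p a x := by
  constructor
  · intro hx
    refine mem_of_reachable (A := {x | Desc p a x}) ?_ hx (.refl p a)
    rintro x hx y hxy
    rw [deleteEdges_adj, Set.mem_singleton_iff] at hxy
    rcases h.adj_cases hxy.1 with ⟨-, hp⟩ | ⟨-, hp⟩
    · refine hp ▸ Desc.parent hx fun hxa => hxy.2 ?_
      rw [← hp, hxa]
    · exact hx.trans (hp ▸ desc_parent p y)
  · rintro ⟨n, hn⟩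
    induction n generalizing x with
    | zero => exact hn ▸ .refl _
    | succ n ih =>
      by_cases hxa : x = a
      · exact hxa ▸ .refl _
      have hxr : x ≠ r := fun hxr => ha (h.eq_root_of_desc ⟨n + 1, hxr ▸ hn⟩)
      refine (ih _ hn).trans (Adj.reachable ?_)
      rw [deleteEdges_adj, Set.mem_singleton_iff]
      refine ⟨h.adj_parent hxr, fun he => ?_⟩
      rcases Sym2.eq_iff.mp he with ⟨h1, h2⟩ | ⟨-, h2⟩
      · have h3 := h.lt x hxr
        have h4 := h.lt a ha
        rw [h1] at h3
        rw [← h2] at h4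
        omega
      · exact hxa h2

theorem reachable_above_iff {a : W} (ha : a ≠ r) (x : W) :
    ((parentGraph p).deleteEdges {s(p a, a)}).Reachable (p a) x ↔ ¬ Desc p a x := by
  constructor
  · intro hx
    refine mem_of_reachable (A := {x | ¬ Desc p a x}) ?_ hx (h.not_desc_parent ha)
    rintro x hx y hxy hy
    rw [deleteEdges_adj, Set.mem_singleton_iff] at hxy
    rcases h.adj_cases hxy.1 with ⟨-, hp⟩ | ⟨-, hp⟩
    · exact hx (hy.trans (hp ▸ desc_parent p x))
    · refine hx (hp ▸ Desc.parent hy fun hya => hxy.2 ?_)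
      rw [← hp, hya]
  -- Ancestors of a non-descendant are non-descendants, so its path to the root avoids the deleted
  -- edge; `p a` and `x` are joined through the root.
  · have key : ∀ x, ¬ Desc p a x → ((parentGraph p).deleteEdges {s(p a, a)}).Reachable r x := by
      intro x hx
      induction hn : d x using Nat.strong_induction_on generalizing x with
      | _ n ih =>
        by_cases hxr : x = r
        · exact hxr ▸ .refl _
        refine (ih _ (hn ▸ h.lt x hxr) (p x) (fun hd => hx (hd.trans (desc_parent p x))) rfl).trans
          (Adj.reachable ?_)
        rw [deleteEdges_adj, Set.mem_singleton_iff]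
        refine ⟨h.adj_parent hxr, fun he => ?_⟩
        rcases Sym2.eq_iff.mp he with ⟨-, h2⟩ | ⟨h1, h2⟩
        · exact hx (h2 ▸ .refl p x)
        · exact hx ((congrArg (Desc p · x) h1).mp (desc_parent p x))
    exact fun hx => (key _ (h.not_desc_parent ha)).symm.trans (key x hx)

theorem isTree : (parentGraph p).IsTree where
  preconnected := by
    have key : ∀ x, (parentGraph p).Reachable r x := by
      intro x
      induction hn : d x using Nat.strong_induction_on generalizing x with
      | _ n ih =>
        by_cases hxr : x = r
        · exact hxr ▸ .refl _
        exact (ih _ (hn ▸ h.lt x hxr) _ rfl).trans (h.adj_parent hxr).reachable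
    exact fun a b => (key a).symm.trans (key b)
  nonempty := ⟨r⟩
  isAcyclic := by
    rw [isAcyclic_iff_forall_adj_isBridge]
    intro v w hvw
    rw [isBridge_iff]
    rcases h.adj_cases hvw with ⟨hv, rfl⟩ | ⟨hw, rfl⟩
    · rw [h.reachable_below_iff hv]
      exact h.not_desc_parent hv
    · rw [h.reachable_above_iff hw]
      exact not_not.mpr (.refl p w)

/-- Every node of `N` climbs to `t` through parents without leaving `N`. -/
theorem connSet {N : Set W} {t : W} (ht : t ∈ N) (hdesc : ∀ b ∈ N, Desc p t b)
    (hN : ∀ b ∈ N, b ≠ t → p b ∈ N) : ConnSet (parentGraph p) N := by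
  have hadj : ∀ b ∈ N, b ≠ t → (parentGraph p).Adj (p b) b := fun b hb hbt =>
    h.adj_parent fun hbr => hbt (hbr.trans (h.eq_root_of_desc (hbr ▸ hdesc b hb)).symm)
  refine ⟨⟨t, ht⟩, fun A ⟨a, ha, haA⟩ hA => ?_⟩
  have htA : t ∈ A := by
    obtain ⟨n, hn⟩ := hdesc a ha
    induction n generalizing a with
    | zero => exact hn ▸ haA
    | succ n ih =>
      by_cases hat : a = t
      · exact hat ▸ haA
      · exact ih (p a) (hN a ha hat) (hA a haA ha _ (hN a ha hat) (hadj a ha hat).symm) hn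
  intro b hb
  obtain ⟨n, hn⟩ := hdesc b hb
  induction n generalizing b with
  | zero => exact (show b = t from hn) ▸ htA
  | succ n ih =>
    by_cases hbt : b = t
    · exact hbt ▸ htA
    · exact hA _ (ih (hN b hb hbt) hn) (hN b hb hbt) b hb (hadj b hb hbt)

/-- A walk missing `p a` would survive the deletion of the edge above `a`, which separates `b` from
the root. -/
theorem parent_mem_support {a b : W} (p' : (parentGraph p).Walk r b) (ha : a ≠ r)
    (hb : Desc p a b) : p a ∈ p'.support := by
  by_contra hs
  have := (p'.toDeleteEdges {s(p a, a)} (by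
    rintro e he rfl
    exact hs (p'.fst_mem_support_of_mem_edges he))).reachable
  have hr := (h.reachable_above_iff ha r).mpr fun hd => ha (h.eq_root_of_desc hd)
  exact (h.reachable_above_iff ha b).mp (hr.trans this) hb

end IsParentFun

/-- In a tree, a path between two nodes of a connected node set stays in that set. -/
theorem ConnSet.support_subset {T : SimpleGraph W} (hT : T.IsAcyclic) {N : Set W}
    (hN : ConnSet T N) {a b : W} (ha : a ∈ N) (hb : b ∈ N) (q : T.Walk a b) (hq : q.IsPath) :
    ∀ t ∈ q.support, t ∈ N := by
  classical
  obtain ⟨w⟩ := hN.preconnected ⟨a, ha⟩ ⟨b, hb⟩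
  have hpath := w.toPath.2.map (f := (Embedding.induce (G := T) N).toHom) Subtype.val_injective
  have heq : q.support = (Walk.map (Embedding.induce (G := T) N).toHom w.toPath.1).support :=
    congrArg (fun x : T.Path a b => x.1.support)
      ((hT.subsingleton_path a b).elim ⟨q, hq⟩ ⟨_, hpath⟩)
  intro t ht
  rw [heq, Walk.support_map, List.mem_map] at ht
  obtain ⟨x, -, rfl⟩ := ht
  exact x.2

end ParentFunction

/-! ### Cutting a rayless graph into branches -/

section Branches

variable {V : Type u} {G : SimpleGraph V}

/-- `rk` is a rank function on the connected vertex sets `C` of the connected graph `G`, and `X`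
selects finite nonempty subsets `X C ⊆ C` such that all components of `C ∖ X C` have smaller
rank. -/
structure IsCut (G : SimpleGraph V) (rk : Set V → Ordinal.{u}) (X : Set V → Set V) : Prop where
  conn : ConnSet G Set.univ
  sub : ∀ C, ConnSet G C → X C ⊆ C
  fin : ∀ C, ConnSet G C → (X C).Finite
  nonempty : ∀ C, ConnSet G C → (X C).Nonempty
  lt : ∀ C, ConnSet G C → ∀ D, IsComp G (C \ X C) D → rk D < rk C

/-- The least `ρ` such that `G[S]` has rank at most `ρ`. -/
noncomputable def setRank (G : SimpleGraph V) (S : Set V) : Ordinal.{u} :=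
  sInf {ρ | RankLE ρ (G.induce S)}

theorem setRank_le {ρ : Ordinal.{u}} {S : Set V} (h : RankLE ρ (G.induce S)) :
    setRank G S ≤ ρ := csInf_le' h

theorem rankLE_setRank {ρ : Ordinal.{u}} (hG : RankLE ρ G) (S : Set V) :
    RankLE (setRank G S) (G.induce S) :=
  csInf_mem (s := {ρ | RankLE ρ (G.induce S)})
    ⟨ρ, (rankLE_induce_univ.mpr hG).induce_mono (Set.subset_univ S)⟩

theorem exists_isCut (hG : G.Connected) {ρ : Ordinal.{u}} (hρ : RankLE ρ G) :
    ∃ X, IsCut G (setRank G) X := by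
  have key : ∀ C, ConnSet G C → ∃ X : Set V, X ⊆ C ∧ X.Finite ∧ X.Nonempty ∧
      ∀ D, IsComp G (C \ X) D → setRank G D < setRank G C := by
    intro C hC
    obtain ⟨X, hX, h⟩ := rankLE_induce_iff.mp (rankLE_setRank hρ C)
    obtain ⟨v, hv⟩ := hC.1
    -- Adding `v` makes the cut nonempty; enlarging the deleted set only shrinks the components.
    refine ⟨insert v (X ∩ C), Set.insert_subset hv Set.inter_subset_right,
      (hX.inter_of_left C).insert v, Set.insert_nonempty _ _, fun D hD => ?_⟩
    obtain ⟨w, hw⟩ := hD.conn.1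
    have hsub : D ⊆ C \ X := fun x hx =>
      ⟨(hD.sub hx).1, fun hxX => (hD.sub hx).2 (Or.inr ⟨hxX, (hD.sub hx).1⟩)⟩
    obtain ⟨β, hβ, hr⟩ := h _ (isComp_compOf (hsub hw))
    exact (setRank_le (hr.induce_mono (hD.conn.subset_of_isComp (isComp_compOf (hsub hw)) hsub
      ⟨w, hw, mem_compOf (hsub hw)⟩))).trans_lt hβ
  choose! X h1 h2 h3 h4 using key
  exact ⟨X, connSet_univ hG, h1, h2, h3, h4⟩

/-- The branch of `v` at level `n`: starting from the whole graph, repeatedly delete `X C` from the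
current branch `C` and pass to the component containing `v`. -/
def branch (G : SimpleGraph V) (X : Set V → Set V) : ℕ → V → Set V
  | 0, _ => Set.univ
  -- Once `v` is deleted, all later branches are empty, so `v ∈ branch G X n v` says that `v`
  -- survives to level `n`.
  | n + 1, v => compOf G (branch G X n v \ X (branch G X n v)) v

/-- The level at which `v` is deleted. -/
noncomputable def height (G : SimpleGraph V) (X : Set V → Set V) (v : V) : ℕ :=
  sInf {n | v ∈ branch G X n v ∧ v ∈ X (branch G X n v)}

/-- The last branch that contains `v`. -/
noncomputable def top (G : SimpleGraph V) (X : Set V → Set V) (v : V) : Set V :=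
  branch G X (height G X v) v

variable {X : Set V → Set V}

theorem branch_succ_subset (n : ℕ) (v : V) :
    branch G X (n + 1) v ⊆ branch G X n v \ X (branch G X n v) := compOf_subset _ _

theorem branch_antitone (v : V) : Antitone fun n => branch G X n v :=
  antitone_nat_of_succ_le fun n => (branch_succ_subset n v).trans Set.sdiff_subset

theorem branch_eq {n : ℕ} {v w : V} (h : w ∈ branch G X n v) :
    branch G X n w = branch G X n v := by
  induction n with
  | zero => rfl
  | succ n ih =>
    have ih' := ih (branch_succ_subset n v h).1
    have h' : w ∈ compOf G (branch G X n v \ X (branch G X n v)) v := h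
    simp only [branch]
    rw [ih']
    exact ((isComp_compOf h.1).eq_compOf h').symm

theorem isComp_branch {n : ℕ} {v : V} (hv : v ∈ branch G X (n + 1) v) :
    IsComp G (branch G X n v \ X (branch G X n v)) (branch G X (n + 1) v) :=
  isComp_compOf (branch_succ_subset n v hv)

theorem branch_eq_top {v w : V} (hw : w ∈ top G X v) :
    branch G X (height G X v) w = top G X v := branch_eq hw

/-- A component of `G - Y` with neighbourhood `Y` that avoids `X C ∪ N(C)`, where `Y` meets
`X C` and `C` is a branch of level `n`, is a branch of level `n + 1` inside `C`. -/
theorem eq_branch_succ {Y K : Set V} {n : ℕ} {v k : V} (hv : v ∈ branch G X n v)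
    (hvY : v ∈ Y) (hYsub : Y ⊆ X (branch G X n v) ∪ nbhd G (branch G X n v))
    (hK : ConnSet G K) (hKY : nbhd G K = Y)
    (hdisj : ∀ x ∈ K, x ∉ X (branch G X n v) ∪ nbhd G (branch G X n v)) (hk : k ∈ K) :
    branch G X n k = branch G X n v ∧ K = branch G X (n + 1) k := by
  -- As `v ∈ N(K)` has a neighbour in `K`, and `K` avoids `N(C)`, that neighbour and then all of `K`
  -- lie in `C`.
  have hKC : K ⊆ branch G X n v := by
    obtain ⟨-, w, hw, hwv⟩ : v ∈ nbhd G K := hKY ▸ hvY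
    have hwC : w ∈ branch G X n v := by
      by_contra hwC
      exact hdisj w hw (Or.inr ⟨hwC, v, hv, hwv.symm⟩)
    exact hK.subset_of_disjoint_nbhd ⟨w, hw, hwC⟩ fun x hx hx' => hdisj x hx (Or.inr hx')
  have heq : branch G X n k = branch G X n v := branch_eq (hKC hk)
  refine ⟨heq, ?_⟩
  have hcomp : IsComp G (branch G X n v \ X (branch G X n v)) K := by
    refine ⟨hK, fun x hx => ⟨hKC hx, fun hxX => hdisj x hx (Or.inl hxX)⟩, fun a ha b hb hab => ?_⟩
    by_contra hbK
    have hbY : b ∈ Y := hKY ▸ ⟨hbK, a, ha, hab⟩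
    rcases hYsub hbY with hbX | hbN
    · exact hb.2 hbX
    · exact hbN.1 hb.1
  rw [branch, heq]
  exact hcomp.eq_compOf hk

theorem nbhd_branch_subset {n : ℕ} {v : V} (hv : v ∈ branch G X (n + 1) v) :
    nbhd G (branch G X (n + 1) v) ⊆ X (branch G X n v) ∪ nbhd G (branch G X n v) := by
  rintro w ⟨hw, x, hx, hxw⟩
  by_cases hwP : w ∈ branch G X n v
  · refine Or.inl ?_
    by_contra hwX
    exact hw ((isComp_branch hv).closed x hx w ⟨hwP, hwX⟩ hxw)
  · exact Or.inr ⟨hwP, x, (branch_succ_subset n v hx).1, hxw⟩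

namespace IsCut

variable {rk : Set V → Ordinal.{u}} (h : IsCut G rk X)
include h

theorem connSet_branch {n : ℕ} {v : V} (hv : v ∈ branch G X n v) :
    ConnSet G (branch G X n v) := by
  cases n with
  | zero => exact h.conn
  | succ n => exact (isComp_compOf (branch_succ_subset n v hv)).conn

/-- A vertex that is never deleted would give an infinite strictly decreasing sequence of ranks. So
the infimum defining `height` is attained. -/
theorem height_spec (v : V) : v ∈ top G X v ∧ v ∈ X (top G X v) := by
  refine Nat.sInf_mem (s := {n | v ∈ branch G X n v ∧ v ∈ X (branch G X n v)}) ?_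
  by_contra hcon
  have hX : ∀ n, v ∈ branch G X n v → v ∉ X (branch G X n v) := fun n h1 h2 => hcon ⟨n, h1, h2⟩
  have hmem : ∀ n, v ∈ branch G X n v := by
    intro n
    induction n with
    | zero => trivial
    | succ n ih => exact mem_compOf ⟨ih, hX n ih⟩
  exact not_strictAnti_of_wellFoundedLT (fun n => rk (branch G X n v))
    (strictAnti_nat_of_succ_lt fun n => h.lt _ (h.connSet_branch (hmem n)) _
      (isComp_branch (hmem (n + 1))))

theorem mem_branch_iff {n : ℕ} {v : V} : v ∈ branch G X n v ↔ n ≤ height G X v := by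
  constructor
  · intro hv
    by_contra hlt
    have := branch_antitone v (Nat.succ_le_of_lt (not_le.mp hlt)) hv
    exact (branch_succ_subset _ v this).2 (h.height_spec v).2
  · exact fun hn => branch_antitone v hn (h.height_spec v).1

theorem height_eq {n : ℕ} {v : V} (hv : v ∈ branch G X n v) (hvX : v ∈ X (branch G X n v)) :
    height G X v = n := by
  refine le_antisymm ?_ (h.mem_branch_iff.mp hv)
  by_contra hlt
  have := h.mem_branch_iff.mpr (Nat.succ_le_of_lt (not_le.mp hlt))
  exact (branch_succ_subset n v this).2 hvX

/-- Any vertex of the nonempty cut of a branch has that branch as its last one; thus every branch is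
a value of `top`. -/
theorem exists_top_eq {n : ℕ} {v : V} (hv : v ∈ branch G X n v) :
    ∃ w, height G X w = n ∧ top G X w = branch G X n v := by
  obtain ⟨w, hw⟩ := h.nonempty _ (h.connSet_branch hv)
  have hwb := h.sub _ (h.connSet_branch hv) hw
  have heq := branch_eq hwb
  have hn : height G X w = n := h.height_eq (heq ▸ hwb) (heq ▸ hw)
  exact ⟨w, hn, by rw [top, hn, heq]⟩

theorem top_connSet (v : V) : ConnSet G (top G X v) := h.connSet_branch (h.height_spec v).1

theorem height_le {v w : V} (hw : w ∈ top G X v) : height G X v ≤ height G X w :=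
  h.mem_branch_iff.mp (by rw [branch_eq_top hw]; exact hw)

theorem top_eq_iff {v w : V} : top G X w = top G X v ↔ w ∈ X (top G X v) := by
  constructor
  · intro heq
    exact heq ▸ (h.height_spec w).2
  · intro hw
    have hwt := h.sub _ (h.top_connSet v) hw
    have heq := branch_eq_top hwt
    have hh : height G X w = height G X v := h.height_eq (heq ▸ hwt) (heq ▸ hw)
    rw [top, hh, heq]

theorem height_eq_of_top_eq {v w : V} (heq : top G X w = top G X v) :
    height G X w = height G X v :=
  le_antisymm (h.height_le (heq ▸ (h.height_spec v).1)) (h.height_le (heq ▸ (h.height_spec w).1))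

theorem top_eq_of_height_le {v w : V} (hw : w ∈ top G X v) (hle : height G X w ≤ height G X v) :
    top G X w = top G X v := by
  rw [top, le_antisymm hle (h.height_le hw), branch_eq_top hw]

theorem branch_eq_of_adj {v w : V} (hvw : G.Adj v w) {n : ℕ} (hv : n ≤ height G X v)
    (hw : n ≤ height G X w) : branch G X n v = branch G X n w := by
  induction n with
  | zero => rfl
  | succ n ih =>
    have ih' := ih (by omega) (by omega)
    have hv' := h.mem_branch_iff.mpr hv
    have hw' := branch_succ_subset n w (h.mem_branch_iff.mpr hw)
    rw [← ih'] at hw'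
    exact (branch_eq ((isComp_branch hv').closed v hv' w hw' hvw)).symm

/-- Adjacent vertices lie in the same branches until one of them is deleted, so a neighbour outside
a branch was deleted earlier. -/
theorem height_lt_of_mem_nbhd {v w : V} (hw : w ∈ nbhd G (top G X v)) :
    height G X w < height G X v := by
  by_contra hle
  obtain ⟨hwv, x, hx, hxw⟩ := hw
  have := h.branch_eq_of_adj hxw (h.height_le hx) (not_lt.mp hle)
  rw [branch_eq_top hx] at this
  exact hwv (this ▸ h.mem_branch_iff.mpr (not_lt.mp hle))

/-- The previous branch is connected, so each component left by its cut attaches to the cut. This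
lets the neighbourhood of a branch determine the branch above it. -/
theorem nbhd_branch_meets {n : ℕ} {v : V} (hv : v ∈ branch G X (n + 1) v) :
    (nbhd G (branch G X (n + 1) v) ∩ X (branch G X n v)).Nonempty := by
  have hP := h.connSet_branch (branch_succ_subset n v hv).1
  by_contra hcon
  obtain ⟨x, hx⟩ := h.nonempty _ hP
  refine (branch_succ_subset n v (hP.2 (branch G X (n + 1) v)
    ⟨v, (branch_succ_subset n v hv).1, hv⟩ ?_ (h.sub _ hP hx))).2 hx
  intro a ha _ b hb hab
  by_contra hbC
  refine hbC ((isComp_branch hv).closed a ha b ⟨hb, fun hbX => ?_⟩ hab)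
  exact hcon ⟨b, ⟨hbC, a, ha, hab⟩, hbX⟩

theorem nbhd_branch_finite {n : ℕ} {v : V} (hv : v ∈ branch G X n v) :
    (nbhd G (branch G X n v)).Finite := by
  induction n with
  | zero =>
    convert Set.finite_empty
    exact Set.eq_empty_of_forall_notMem fun x hx => hx.1 trivial
  | succ n ih =>
    have hv' := (branch_succ_subset n v hv).1
    exact ((h.fin _ (h.connSet_branch hv')).union (ih hv')).subset (nbhd_branch_subset hv)

/-! ### Critical vertex sets and branches -/

/-- A component with empty neighbourhood is all of the connected graph, so there is at most one. -/
theorem crit_nonempty {Y : Set V} (hY : Y ∈ crit G) : Y.Nonempty := by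
  by_contra hcon
  rw [Set.not_nonempty_iff_eq_empty] at hcon
  refine hY.2 (Set.Subsingleton.finite ?_)
  have key : ∀ K ∈ compsWithNbhd G Y Y, (K : Set V) = Set.univ := by
    intro K hK
    have hK' : nbhd G (K : Set V) = Y := hK
    refine Set.univ_subset_iff.mp (h.conn.subset_of_disjoint_nbhd ?_ fun v _ => ?_)
    · obtain ⟨x, hx⟩ := K.nonempty
      exact ⟨x, trivial, hx⟩
    · rw [hK', hcon]
      exact Set.notMem_empty v
  intro K hK K' hK'
  exact SetLike.coe_injective ((key K hK).trans (key K' hK').symm)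

theorem exists_max_height {Y : Set V} (hY : Y ∈ crit G) :
    ∃ v ∈ Y, ∀ w ∈ Y, height G X w ≤ height G X v :=
  hY.1.exists_maximalFor (height G X) Y (h.crit_nonempty hY) |>.imp fun _ hv =>
    ⟨hv.1, fun _ hw => (le_total _ _).elim id fun hle => hv.2 hw hle⟩

theorem finite_bag (v : V) : (X (top G X v) ∪ nbhd G (top G X v)).Finite :=
  (h.fin _ (h.top_connSet v)).union (h.nbhd_branch_finite (h.height_spec v).1)

/-- Among infinitely many components with neighbourhood `Y`, one avoids the finite set `N(C)`, where
`C` is the last branch of `v`. It has a neighbour `v ∈ C`, so it lies in `C`, and `Y ⊆ C ∪ N(C)`.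
Maximality of the height puts `Y ∩ C` into `X C`. -/
theorem crit_subset {Y : Set V} (hY : Y ∈ crit G) {v : V} (hv : v ∈ Y)
    (hmax : ∀ w ∈ Y, height G X w ≤ height G X v) :
    Y ⊆ X (top G X v) ∪ nbhd G (top G X v) := by
  have hfin := h.nbhd_branch_finite (h.height_spec v).1
  obtain ⟨K, hK, hKd⟩ := (hY.2.sdiff (finite_componentCompl_meeting (X := Y) hfin)).nonempty
  have hK' : nbhd G (K : Set V) = Y := hK
  have hKC : (K : Set V) ⊆ top G X v := by
    obtain ⟨-, w, hw, hwv⟩ : v ∈ nbhd G (K : Set V) := by rwa [hK']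
    have hdisj : ∀ x ∈ (K : Set V), x ∉ nbhd G (top G X v) := fun x hx hx' => hKd ⟨x, hx, hx'⟩
    refine (isComp_componentCompl K).conn.subset_of_disjoint_nbhd ⟨w, hw, ?_⟩ hdisj
    by_contra hwC
    exact hdisj w hw ⟨hwC, v, (h.height_spec v).1, hwv.symm⟩
  intro y hy
  by_cases hyC : y ∈ top G X v
  · exact Or.inl (h.top_eq_iff.mp (h.top_eq_of_height_le hyC (hmax y hy)))
  · obtain ⟨-, w, hw, hwy⟩ : y ∈ nbhd G (K : Set V) := by rwa [hK']
    exact Or.inr ⟨hyC, w, hKC hw, hwy⟩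

/-- Vertices of the neighbourhood of a branch have smaller height than those of its cut, so a
highest vertex of `Y` lies in the cut. Hence `Y` determines the branch. -/
theorem top_eq_of_subset {Y : Set V} {v x : V} (hv : v ∈ Y)
    (hmax : ∀ w ∈ Y, height G X w ≤ height G X v)
    (hYsub : Y ⊆ X (top G X x) ∪ nbhd G (top G X x)) (hYm : (Y ∩ X (top G X x)).Nonempty) :
    top G X v = top G X x := by
  obtain ⟨y, hy, hyX⟩ := hYm
  have h1 := h.height_eq_of_top_eq (h.top_eq_iff.mpr hyX)
  have h2 := hmax y hy
  rcases hYsub hv with hvX | hvN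
  · exact h.top_eq_iff.mpr hvX
  · have h3 := h.height_lt_of_mem_nbhd hvN
    omega

end IsCut

end Branches

/-! ### The decomposition tree -/

section DecompositionTree

variable {V : Type u} {G : SimpleGraph V} {X : Set V → Set V} {rk : Set V → Ordinal.{u}}

/-- The nodes of the decomposition tree: the branches and the critical vertex sets. -/
abbrev Node (G : SimpleGraph V) (X : Set V → Set V) : Type u := Set.range (top G X) ⊕ crit G

/-- The part at a node. -/
def bag (a : Node G X) : Set V :=
  match a with
  | Sum.inl C => X C ∪ nbhd G (C : Set V)
  | Sum.inr Y => Y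

/-- The intersection of the part at a node with the part at its parent. -/
def adh (a : Node G X) : Set V :=
  match a with
  | Sum.inl C => nbhd G (C : Set V)
  | Sum.inr Y => Y

/-- The vertices that appear only in parts below a node. -/
def core (a : Node G X) : Set V :=
  match a with
  | Sum.inl C => C
  | Sum.inr Y => {v | ∃ D ∈ Set.range (top G X), nbhd G D = Y ∧ v ∈ D}

/-- The node whose branch is the last one that contains `v`. -/
def topNode (G : SimpleGraph V) (X : Set V → Set V) (v : V) : Node G X :=
  Sum.inl ⟨top G X v, v, rfl⟩

theorem nbhd_univ : nbhd G (Set.univ : Set V) = ∅ :=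
  Set.eq_empty_of_forall_notMem fun _ hx => hx.1 trivial

theorem adh_subset_bag (a : Node G X) : adh a ⊆ bag a := by
  rcases a with C | Y
  · exact Set.subset_union_right
  · exact subset_rfl

namespace IsCut

variable (h : IsCut G rk X)
include h

theorem branch_mem_range {n : ℕ} {v : V} (hv : v ∈ branch G X n v) :
    branch G X n v ∈ Set.range (top G X) := by
  obtain ⟨w, -, hw⟩ := h.exists_top_eq hv
  exact ⟨w, hw⟩

theorem mem_branch_pred (v : V) : v ∈ branch G X (height G X v - 1) v :=
  h.mem_branch_iff.mpr (Nat.sub_le _ _)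

/-- The parent function of the decomposition tree. -/
noncomputable def parent (a : Node G X) : Node G X :=
  open Classical in
  match a with
  -- A non-critical neighbourhood leads to the branch one level up; truncated subtraction makes the
  -- root its own parent.
  | Sum.inl C => if hN : nbhd G (C : Set V) ∈ crit G then Sum.inr ⟨_, hN⟩
      else Sum.inl ⟨_, h.branch_mem_range (h.mem_branch_pred C.2.choose)⟩
  | Sum.inr Y => topNode G X (h.exists_max_height Y.2).choose

/-- The root of the decomposition tree. -/
def root : Node G X :=
  Sum.inl ⟨Set.univ, by
    obtain ⟨v, -⟩ := h.conn.1
    exact h.branch_mem_range (n := 0) (v := v) trivial⟩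

/-- A height function witnessing that the decomposition tree is a tree. -/
noncomputable def depth (a : Node G X) : ℕ :=
  match a with
  -- Doubling leaves the odd depths for the critical sets inserted between consecutive levels.
  | Sum.inl C => 2 * height G X C.2.choose
  | Sum.inr Y => 2 * height G X (h.exists_max_height Y.2).choose + 1

theorem height_choose {C : Set.range (top G X)} {n : ℕ} {v : V} (hv : v ∈ branch G X n v)
    (hC : (C : Set V) = branch G X n v) : height G X C.2.choose = n := by
  obtain ⟨w, hw, hwC⟩ := h.exists_top_eq hv
  rw [← hw]
  exact h.height_eq_of_top_eq (by rw [C.2.choose_spec, hC, hwC])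

theorem depth_inl {C : Set.range (top G X)} {n : ℕ} {v : V} (hv : v ∈ branch G X n v)
    (hC : (C : Set V) = branch G X n v) : h.depth (Sum.inl C) = 2 * n :=
  congrArg (2 * ·) (h.height_choose hv hC)

/-- Every branch is the root or a branch of positive level. -/
theorem eq_root_or (C : Set.range (top G X)) : Sum.inl C = h.root ∨
    ∃ (P : Set.range (top G X)) (n : ℕ) (v : V), v ∈ branch G X (n + 1) v ∧
      (C : Set V) = branch G X (n + 1) v ∧ (P : Set V) = branch G X n v := by
  obtain ⟨_, v, rfl⟩ := C
  rcases hn : height G X v with _ | n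
  · refine Or.inl (congrArg Sum.inl (Subtype.ext ?_))
    simp [top, hn, branch]
  · have hv := h.height_spec v
    rw [top, hn] at hv
    exact Or.inr ⟨⟨_, h.branch_mem_range (branch_succ_subset n v hv.1).1⟩, n, v, hv.1,
      by simp [top, hn], rfl⟩

theorem empty_notMem_crit : (∅ : Set V) ∉ crit G := fun h' => (h.crit_nonempty h').ne_empty rfl

theorem parent_root : h.parent h.root = h.root := by
  have hN : nbhd G (Set.univ : Set V) ∉ crit G := by
    rw [nbhd_univ]
    exact h.empty_notMem_crit
  have key : ∀ C : Set.range (top G X), (C : Set V) = Set.univ →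
      h.parent (Sum.inl C) = Sum.inl C := by
    intro C hC
    obtain ⟨v, -⟩ := h.conn.1
    rw [← hC] at hN
    simp only [parent, hN, dite_false]
    refine congrArg Sum.inl (Subtype.ext ?_)
    simp only
    rw [h.height_choose (n := 0) (v := v) trivial hC]
    exact hC.symm
  exact key _ rfl

theorem parent_inl {C P : Set.range (top G X)} {n : ℕ} {v : V} (hv : v ∈ branch G X (n + 1) v)
    (hC : (C : Set V) = branch G X (n + 1) v) (hP : (P : Set V) = branch G X n v)
    (hN : nbhd G (C : Set V) ∉ crit G) : h.parent (Sum.inl C) = Sum.inl P := by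
  simp only [parent, hN, dite_false]
  refine congrArg Sum.inl (Subtype.ext ?_)
  simp only
  rw [h.height_choose hv hC, hP, Nat.add_sub_cancel]
  refine branch_eq (branch_succ_subset n v ?_).1
  rw [← hC]
  have := (h.height_spec C.2.choose).1
  rwa [C.2.choose_spec] at this

theorem parent_inl_of_crit {C : Set.range (top G X)} (hN : nbhd G (C : Set V) ∈ crit G) :
    h.parent (Sum.inl C) = Sum.inr ⟨_, hN⟩ := by
  simp only [parent, hN, dite_true]

theorem exists_parent_inr (Y : crit G) : ∃ v ∈ (Y : Set V),
    (∀ w ∈ (Y : Set V), height G X w ≤ height G X v) ∧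
    h.parent (Sum.inr Y) = topNode G X v ∧ h.depth (Sum.inr Y) = 2 * height G X v + 1 :=
  ⟨_, (h.exists_max_height Y.2).choose_spec.1, (h.exists_max_height Y.2).choose_spec.2, rfl, rfl⟩

/-- The neighbourhood of `C` lies in the part of `P` and meets the cut of `P`, so `top_eq_of_subset`
applies. In particular, all branches with neighbourhood `Y` have the same predecessor branch. -/
theorem parent_inr {C P : Set.range (top G X)} {n : ℕ} {v : V} (hv : v ∈ branch G X (n + 1) v)
    (hC : (C : Set V) = branch G X (n + 1) v) (hP : (P : Set V) = branch G X n v)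
    {Y : crit G} (hN : nbhd G (C : Set V) = Y) :
    h.parent (Sum.inr Y) = Sum.inl P ∧ h.depth (Sum.inr Y) = 2 * n + 1 := by
  obtain ⟨y, hy, hmax, hp, hd⟩ := h.exists_parent_inr Y
  obtain ⟨x, hx, hxP⟩ := h.exists_top_eq (branch_succ_subset n v hv).1
  have heq : top G X y = top G X x := by
    refine h.top_eq_of_subset hy hmax ?_ ?_
    · rw [hxP, ← hN, hC]
      exact nbhd_branch_subset hv
    · rw [hxP, ← hN, hC]
      exact h.nbhd_branch_meets hv
  rw [hp, hd, h.height_eq_of_top_eq heq, hx]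
  exact ⟨congrArg Sum.inl (Subtype.ext (by rw [hP, ← hxP]; exact heq)), rfl⟩

theorem isParentFun : IsParentFun h.parent h.root h.depth where
  root := h.parent_root
  lt a ha := by
    rcases a with C | Y
    · obtain hr | ⟨P, n, v, hv, hC, hP⟩ := h.eq_root_or C
      · exact absurd hr ha
      have hd := h.depth_inl hv hC
      by_cases hN : nbhd G (C : Set V) ∈ crit G
      · rw [h.parent_inl_of_crit hN, (h.parent_inr hv hC hP rfl).2, hd]
        omega
      · rw [h.parent_inl hv hC hP hN, hd, h.depth_inl (branch_succ_subset n v hv).1 hP]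
        omega
    · obtain ⟨y, hy, hmax, hp, hd⟩ := h.exists_parent_inr Y
      rw [hp, hd, topNode, h.depth_inl (n := height G X y) (h.height_spec y).1 rfl]
      omega

theorem inr_ne_root (Y : crit G) : Sum.inr Y ≠ h.root := by
  simp [root]

/-- A branch of positive level is a child of its predecessor branch, or a grandchild via the
critical vertex set that is its neighbourhood. -/
theorem parent_cases {C P : Set.range (top G X)} {n : ℕ} {v : V}
    (hv : v ∈ branch G X (n + 1) v)
    (hC : (C : Set V) = branch G X (n + 1) v) (hP : (P : Set V) = branch G X n v) :
    (nbhd G (C : Set V) ∉ crit G ∧ h.parent (Sum.inl C) = Sum.inl P) ∨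
    ∃ Y : crit G, nbhd G (C : Set V) = Y ∧ h.parent (Sum.inl C) = Sum.inr Y ∧
      h.parent (Sum.inr Y) = Sum.inl P := by
  by_cases hN : nbhd G (C : Set V) ∈ crit G
  · exact Or.inr ⟨⟨_, hN⟩, rfl, h.parent_inl_of_crit hN, (h.parent_inr hv hC hP rfl).1⟩
  · exact Or.inl ⟨hN, h.parent_inl hv hC hP hN⟩

theorem parent_inl_eq_inr_iff {C : Set.range (top G X)} {Y : crit G} :
    h.parent (Sum.inl C) = Sum.inr Y ↔ nbhd G (C : Set V) = Y := by
  constructor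
  · intro hp
    by_cases hN : nbhd G (C : Set V) ∈ crit G
    · rw [h.parent_inl_of_crit hN] at hp
      exact congrArg Subtype.val (Sum.inr_injective hp)
    · simp [parent, hN] at hp
  · intro hN
    have hN' : nbhd G (C : Set V) ∈ crit G := hN ▸ Y.2
    rw [h.parent_inl_of_crit hN']
    exact congrArg Sum.inr (Subtype.ext hN)

theorem bag_subset_of_parent_inr {Y : crit G} {C : Set.range (top G X)}
    (hp : h.parent (Sum.inr Y) = Sum.inl C) : (Y : Set V) ⊆ X C ∪ nbhd G (C : Set V) := by
  obtain ⟨y, hy, hmax, hp', -⟩ := h.exists_parent_inr Y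
  rw [hp', topNode] at hp
  rw [← Sum.inl_injective hp]
  exact h.crit_subset Y.2 hy hmax

theorem exists_parent_inr_eq (Y : crit G) :
    ∃ C : Set.range (top G X), h.parent (Sum.inr Y) = Sum.inl C := by
  obtain ⟨y, -, -, hp, -⟩ := h.exists_parent_inr Y
  exact ⟨_, hp⟩

/-! ### Vertices, parts and the tree order -/

theorem core_subset_parent (a : Node G X) : core a ⊆ core (h.parent a) := by
  rcases a with C | Y
  · obtain hr | ⟨P, n, v, hv, hC, hP⟩ := h.eq_root_or C
    · rw [hr, h.parent_root]
    rcases h.parent_cases hv hC hP with ⟨-, hp⟩ | ⟨Y, hY, hp, -⟩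
    · rw [hp]
      simp only [core, hC, hP]
      exact fun x hx => (branch_succ_subset n v hx).1
    · rw [hp]
      exact fun x hx => ⟨C, C.2, hY, hx⟩
  · rintro x ⟨D, hD, hDY, hx⟩
    obtain hr | ⟨P, n, v, hv, hC, hP⟩ := h.eq_root_or ⟨D, hD⟩
    · have hDu : D = Set.univ := congrArg Subtype.val (Sum.inl_injective hr)
      rw [hDu, nbhd_univ] at hDY
      exact absurd (hDY ▸ Y.2) h.empty_notMem_crit
    · rw [(h.parent_inr hv hC hP hDY).1]
      simp only [core, hP]
      exact (branch_succ_subset n v (by rw [← hC]; exact hx)).1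

theorem core_subset_of_desc {a b : Node G X} (hab : Desc h.parent a b) : core b ⊆ core a := by
  obtain ⟨n, hn⟩ := hab
  induction n generalizing b with
  | zero => exact (show b = a from hn) ▸ subset_rfl
  | succ n ih => exact (h.core_subset_parent b).trans (ih hn)

theorem mem_bag_topNode (v : V) : v ∈ bag (topNode G X v) := Or.inl (h.height_spec v).2

theorem desc_topNode_of_mem {C : Set.range (top G X)} {v : V} (hv : v ∈ (C : Set V)) :
    Desc h.parent (Sum.inl C) (topNode G X v) := by
  obtain ⟨_, w, rfl⟩ := C
  -- Induction on the number `k` of levels down to the last branch of `v`; each level costs one or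
  -- two parent steps.
  have key : ∀ k n, n + k = height G X v → ∀ C : Set.range (top G X),
      (C : Set V) = branch G X n v → Desc h.parent (Sum.inl C) (topNode G X v) := by
    intro k
    induction k with
    | zero =>
      intro n hn C hC
      have : Sum.inl C = topNode G X v := congrArg Sum.inl (Subtype.ext (by
        rw [hC]
        show branch G X n v = branch G X (height G X v) v
        rw [← hn, Nat.add_zero]))
      exact this ▸ .refl _ _
    | succ k ih =>
      intro n hn C hC
      have hv' : v ∈ branch G X (n + 1) v := h.mem_branch_iff.mpr (by omega)
      refine Desc.trans ?_ (ih (n + 1) (by omega) ⟨_, h.branch_mem_range hv'⟩ rfl)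
      rcases h.parent_cases (C := ⟨_, h.branch_mem_range hv'⟩) hv' rfl hC with
        ⟨-, hp⟩ | ⟨Y, -, hp, hp'⟩
      · exact ⟨1, hp⟩
      · exact ⟨2, by rw [Function.iterate_succ_apply, hp, Function.iterate_one, hp']⟩
  have hle := h.height_le hv
  exact key (height G X v - height G X w) (height G X w) (by omega) _ (branch_eq_top hv).symm

theorem mem_core_iff {a : Node G X} {v : V} :
    v ∈ core a ↔ Desc h.parent a (topNode G X v) := by
  constructor
  · intro hv
    rcases a with C | Y
    · exact h.desc_topNode_of_mem hv
    · obtain ⟨D, hD, hDY, hvD⟩ := hv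
      have := h.desc_topNode_of_mem (C := ⟨D, hD⟩) hvD
      refine Desc.trans ⟨1, ?_⟩ this
      exact h.parent_inl_eq_inr_iff.mpr hDY
  · exact fun hd => h.core_subset_of_desc hd (h.height_spec v).1

theorem bag_subset (a : Node G X) : bag a ⊆ core a ∪ adh a := by
  rcases a with ⟨_, w, rfl⟩ | Y
  · exact Set.union_subset_union_left _ (h.sub _ (h.top_connSet w))
  · exact Set.subset_union_right

theorem adh_root : adh h.root = ∅ := nbhd_univ

theorem adh_subset_bag_parent (a : Node G X) : adh a ⊆ bag (h.parent a) := by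
  rcases a with C | Y
  · obtain hr | ⟨P, n, v, hv, hC, hP⟩ := h.eq_root_or C
    · rw [hr, h.adh_root]
      exact Set.empty_subset _
    rcases h.parent_cases hv hC hP with ⟨-, hp⟩ | ⟨Y, hY, hp, -⟩
    · rw [hp]
      simp only [adh, bag, hC, hP]
      exact nbhd_branch_subset hv
    · rw [hp]
      exact hY.subset
  · obtain ⟨C, hC⟩ := h.exists_parent_inr_eq Y
    rw [hC]
    exact h.bag_subset_of_parent_inr hC

theorem mem_adh_of_mem_bag {a : Node G X} {v : V} (hv : v ∈ bag a) (hne : a ≠ topNode G X v) :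
    v ∈ adh a := by
  rcases a with ⟨_, w, rfl⟩ | Y
  · rcases hv with hv | hv
    · exact absurd (congrArg Sum.inl (Subtype.ext (h.top_eq_iff.mpr hv).symm)) hne
    · exact hv
  · exact hv

/-- Unless `a` is the top node of `v`, the vertex lies in the adhesion set of `a` and hence in the
parent's part; climbing ends at the top node. -/
theorem desc_of_mem_bag {a : Node G X} {v : V} (hv : v ∈ bag a) :
    Desc h.parent (topNode G X v) a := by
  induction hn : h.depth a using Nat.strong_induction_on generalizing a with
  | _ n ih =>
    by_cases hne : a = topNode G X v
    · exact hne ▸ .refl _ _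
    have hadh := h.mem_adh_of_mem_bag hv hne
    have hr : a ≠ h.root := by
      rintro rfl
      rw [h.adh_root] at hadh
      exact hadh
    exact (ih _ (hn ▸ h.isParentFun.lt a hr) (h.adh_subset_bag_parent a hadh) rfl).trans
      (desc_parent _ a)

theorem below_subset_parent (a : Node G X) :
    core a ∪ adh a ⊆ core (h.parent a) ∪ adh (h.parent a) :=
  Set.union_subset ((h.core_subset_parent a).trans Set.subset_union_left)
    ((h.adh_subset_bag_parent a).trans (h.bag_subset _))

theorem below_subset_of_desc {a b : Node G X} (hab : Desc h.parent a b) :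
    core b ∪ adh b ⊆ core a ∪ adh a := by
  obtain ⟨n, hn⟩ := hab
  induction n generalizing b with
  | zero => exact (show b = a from hn) ▸ subset_rfl
  | succ n ih => exact (h.below_subset_parent b).trans (ih hn)

theorem iUnion_bag_below (a : Node G X) :
    ⋃ x ∈ {x | Desc h.parent a x}, bag x = core a ∪ adh a := by
  apply subset_antisymm
  · exact Set.iUnion₂_subset fun x hx => (h.bag_subset x).trans (h.below_subset_of_desc hx)
  · rintro v (hv | hv)
    · exact Set.mem_biUnion (h.mem_core_iff.mp hv) (h.mem_bag_topNode v)
    · exact Set.mem_biUnion (Desc.refl _ a) (adh_subset_bag a hv)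

theorem iUnion_bag_above (a : Node G X) :
    ⋃ x ∈ {x | ¬ Desc h.parent a x}, bag x = (core a)ᶜ := by
  apply subset_antisymm
  · refine Set.iUnion₂_subset fun x hx v hv hva => hx ?_
    exact (h.mem_core_iff.mp hva).trans (h.desc_of_mem_bag hv)
  · exact fun v hv => Set.mem_biUnion (fun hd => hv (h.mem_core_iff.mpr hd)) (h.mem_bag_topNode v)

theorem bag_finite (a : Node G X) : (bag a).Finite := by
  rcases a with ⟨_, w, rfl⟩ | Y
  · exact h.finite_bag w
  · exact Y.2.1

theorem connSet_bag (v : V) : ConnSet (parentGraph h.parent) {a : Node G X | v ∈ bag a} :=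
  h.isParentFun.connSet (t := topNode G X v) (h.mem_bag_topNode v)
    (fun _ hb => h.desc_of_mem_bag hb)
    fun b hb hne => h.adh_subset_bag_parent b (h.mem_adh_of_mem_bag hb hne)

theorem exists_bag_of_adj {v w : V} (hvw : G.Adj v w) :
    ∃ a : Node G X, v ∈ bag a ∧ w ∈ bag a := by
  wlog hle : height G X w ≤ height G X v generalizing v w
  · obtain ⟨a, h1, h2⟩ := this hvw.symm (le_of_not_ge hle)
    exact ⟨a, h2, h1⟩
  -- The last branch of the vertex deleted later has the other vertex in its cut or in its
  -- neighbourhood.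
  refine ⟨topNode G X v, h.mem_bag_topNode v, ?_⟩
  by_cases hw : w ∈ top G X v
  · exact Or.inl (h.top_eq_iff.mp (h.top_eq_of_height_le hw hle))
  · exact Or.inr ⟨hw, v, (h.height_spec v).1, hvw⟩

/-- The tree-decomposition into the bags. -/
noncomputable def decomposition : TreeDecomposition G (Node G X) where
  tree := parentGraph h.parent
  isTree := h.isParentFun.isTree
  part := bag
  vertex_mem v := ⟨_, h.mem_bag_topNode v⟩
  edge_mem _ _ hvw := h.exists_bag_of_adj hvw
  inter_subset _ t₂ _ q hq ht₂ _ hv :=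
    (h.connSet_bag _).support_subset h.isParentFun.isTree.isAcyclic hv.1 hv.2 q hq t₂ ht₂

theorem sep_parent {a : Node G X} (ha : a ≠ h.root) :
    h.decomposition.sep (h.parent a) a = ((core a)ᶜ, core a ∪ adh a) := by
  have h1 : h.decomposition.side (h.parent a) a = {x | ¬ Desc h.parent a x} :=
    Set.ext fun x => h.isParentFun.reachable_above_iff ha x
  have h2 : h.decomposition.side a (h.parent a) = {x | Desc h.parent a x} :=
    Set.ext fun x => h.isParentFun.reachable_below_iff ha x
  rw [TreeDecomposition.sep, h1, h2]
  exact Prod.ext (h.iUnion_bag_above a) (h.iUnion_bag_below a)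

theorem sep_child {a : Node G X} (ha : a ≠ h.root) :
    h.decomposition.sep a (h.parent a) = (core a ∪ adh a, (core a)ᶜ) :=
  congrArg Prod.swap (h.sep_parent ha)

end IsCut

end DecompositionTree

/-! ### The decomposition displays the combinatorial remainder -/

section Display

variable {V : Type u} {G : SimpleGraph V} {X : Set V → Set V} {rk : Set V → Ordinal.{u}}

theorem compsUnion_compl {Y : Set V} (𝒞 : Set (G.ComponentCompl Y)) :
    compsUnion 𝒞ᶜ = (Y ∪ compsUnion 𝒞)ᶜ := by
  ext v
  simp only [compsUnion, Set.mem_iUnion, Set.mem_compl_iff, Set.mem_union, not_or]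
  constructor
  · rintro ⟨C, hC, hv⟩
    refine ⟨ComponentCompl.notMem_of_mem hv, ?_⟩
    rintro ⟨D, hD, hv'⟩
    have : C = D := by
      by_contra hne
      exact Set.disjoint_left.mp (ComponentCompl.pairwise_disjoint hne) hv hv'
    exact hC (this ▸ hD)
  · rintro ⟨hv, hv'⟩
    exact ⟨G.componentComplMk hv, fun hC => hv' ⟨_, hC, G.componentComplMk_mem hv⟩,
      G.componentComplMk_mem hv⟩

theorem IsTameSep.swap {P : Set V × Set V} (h : IsTameSep G P) : IsTameSep G P.swap := by
  obtain ⟨Y, 𝒞, hY, rfl, ht⟩ := h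
  refine ⟨Y, 𝒞ᶜ, hY, ?_, fun Z hZ hcon => ht Z hZ ⟨by simpa using hcon.2, hcon.1⟩⟩
  have hd : Disjoint Y (compsUnion 𝒞) := by
    rw [Set.disjoint_left]
    intro v hv hv'
    simp only [compsUnion, Set.mem_iUnion] at hv'
    obtain ⟨C, -, hvC⟩ := hv'
    exact ComponentCompl.notMem_of_mem hvC hv
  refine Prod.ext ?_ ?_
  · simp only [orientedSep, compsUnion_compl, Prod.swap, compl_compl]
  · simp only [orientedSep, compsUnion_compl, Prod.swap]
    ext v
    have : v ∈ Y → v ∉ compsUnion 𝒞 := fun hv => Set.disjoint_left.mp hd hv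
    simp only [Set.mem_compl_iff, Set.mem_union]
    tauto

/-- A critical vertex set does not orient two separations towards sides with finite
intersection. -/
theorem infinite_inter_of_orientsTowards {Y : crit G} {P Q : Set V × Set V}
    (hP : OrientsTowards (Sum.inr Y) P) (hQ : OrientsTowards (Sum.inr Y) Q) :
    (P.2 ∩ Q.2).Infinite := by
  intro hfin
  refine Y.2.2 (((hP.2.union hQ.2).union
    (finite_componentCompl_meeting (X := (Y : Set V)) hfin)).subset fun K hK => ?_)
  by_cases h1 : (K : Set V) ⊆ P.2
  · by_cases h2 : (K : Set V) ⊆ Q.2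
    · obtain ⟨x, hx⟩ := K.nonempty
      exact Or.inr ⟨x, hx, h1 hx, h2 hx⟩
    · exact Or.inl (Or.inr ⟨hK, h2⟩)
  · exact Or.inl (Or.inl ⟨hK, h1⟩)

theorem isEmpty_graphEnd (hG : IsRayless G) :
    IsEmpty (GraphEnd G) :=
  ⟨fun ω => Quotient.inductionOn ω fun R => hG.false R⟩

/-- The components of `G - adh a` that make up `core a`. -/
def sepComps (a : Node G X) : Set (G.ComponentCompl (adh a)) :=
  {K | (K : Set V) ∈ Set.range (top G X) ∧ nbhd G (K : Set V) = adh a ∧ (K : Set V) ⊆ core a}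

namespace IsCut

variable (h : IsCut G rk X)
include h

theorem adh_finite (a : Node G X) : (adh a).Finite := (h.bag_finite a).subset (adh_subset_bag a)

theorem connSet_of_mem_range {D : Set V} (hD : D ∈ Set.range (top G X)) : ConnSet G D := by
  obtain ⟨w, rfl⟩ := hD
  exact h.top_connSet w

theorem compsUnion_sepComps (a : Node G X) : compsUnion (sepComps a) = core a := by
  apply subset_antisymm
  · exact Set.iUnion₂_subset fun K hK => hK.2.2
  · intro v hv
    have key : ∃ D ∈ Set.range (top G X), nbhd G D = adh a ∧ D ⊆ core a ∧ v ∈ D := by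
      rcases a with C | Y
      · exact ⟨C, C.2, rfl, subset_rfl, hv⟩
      · obtain ⟨D, hD, hDY, hvD⟩ := hv
        exact ⟨D, hD, hDY, fun x hx => ⟨D, hD, hDY, hx⟩, hvD⟩
    obtain ⟨D, hD, hDa, hDc, hvD⟩ := key
    obtain ⟨K, rfl⟩ := ((h.connSet_of_mem_range hD).isComp_of_nbhd hDa).exists_componentCompl
    exact Set.mem_biUnion (show K ∈ sepComps a from ⟨hD, hDa, hDc⟩) hvD

theorem sep_parent_eq_orientedSep {a : Node G X} (ha : a ≠ h.root) :
    h.decomposition.sep (h.parent a) a = orientedSep (adh a) (sepComps a) := by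
  rw [h.sep_parent ha, orientedSep, h.compsUnion_sepComps, Set.union_comm]

/-- All but finitely many of the components of `G - Y` with neighbourhood `Y`, where `Y` is
critical, are branches. -/
theorem finite_comps_notMem_range (Y : crit G) :
    {K ∈ compsWithNbhd G (Y : Set V) Y | (K : Set V) ∉ Set.range (top G X)}.Finite := by
  obtain ⟨y, hy, hmax⟩ := h.exists_max_height Y.2
  refine (finite_componentCompl_meeting (X := (Y : Set V)) (h.finite_bag y)).subset ?_
  rintro K ⟨hK, hKr⟩
  by_contra hcon
  obtain ⟨k, hk⟩ := K.nonempty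
  have hkey := (eq_branch_succ (h.height_spec y).1 hy (h.crit_subset Y.2 hy hmax)
    (isComp_componentCompl K).conn hK (fun x hx hx' => hcon ⟨x, hx, hx'⟩) hk).2
  apply hKr
  rw [hkey]
  exact h.branch_mem_range (hkey ▸ hk)

/-- Above a branch the separation cuts off a single component. Above a critical `Y` it cuts off only
components with neighbourhood `Y`, and all but finitely many of those. -/
theorem isTameSep_parent {a : Node G X} (ha : a ≠ h.root) :
    IsTameSep G (h.decomposition.sep (h.parent a) a) := by
  refine ⟨adh a, sepComps a, h.adh_finite a, h.sep_parent_eq_orientedSep ha, ?_⟩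
  rintro Z - ⟨h1, h2⟩
  rcases a with C | Y
  · refine h1 (Set.Subsingleton.finite ?_)
    have key : ∀ K ∈ sepComps (Sum.inl C : Node G X), (K : Set V) = C := by
      intro K hK
      obtain ⟨x, hx⟩ := K.nonempty
      exact (isComp_componentCompl K).eq (h.connSet_of_mem_range C.2).isComp_compl_nbhd
        ⟨x, hx, hK.2.2 hx⟩
    intro K hK K' hK'
    exact SetLike.coe_injective ((key K hK.1).trans (key K' hK'.1).symm)
  · by_cases hZ : Z = Y
    · subst hZ
      refine h2 ((h.finite_comps_notMem_range Y).subset ?_)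
      rintro K ⟨hK, hKY⟩
      exact ⟨hKY, fun hKr => hK ⟨hKr, hKY, fun x hx => ⟨K, hKr, hKY, hx⟩⟩⟩
    · obtain ⟨K, hK, hKZ⟩ := h1.nonempty
      exact hZ ((show nbhd G (K : Set V) = Z from hKZ).symm.trans hK.2.1)

theorem decomposition_isTame : h.decomposition.IsTame := by
  intro s t hst
  rcases h.isParentFun.adj_cases hst with ⟨hs, rfl⟩ | ⟨ht, rfl⟩
  · exact (h.isTameSep_parent hs).swap
  · exact h.isTameSep_parent ht

/-! ### Critical vertex sets live at their own nodes -/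

theorem livesAt_inr (Y : crit G) : h.decomposition.LivesAt (Sum.inr Y) (Sum.inr Y) := by
  intro s hs
  rcases h.isParentFun.adj_cases hs with ⟨hsr, hp⟩ | ⟨ht, rfl⟩
  · have hsep := h.sep_child hsr
    rw [hp] at hsep
    rw [hsep]
    rcases s with D | Z
    · have hDY := h.parent_inl_eq_inr_iff.mp hp
      refine ⟨fun y hy hyD => ?_, Set.Subsingleton.finite ?_⟩
      · rw [← hDY] at hy
        exact hy.1 hyD
      · have key : ∀ K ∈ {K ∈ compsWithNbhd G (Y : Set V) Y | ¬ (K : Set V) ⊆ (D : Set V)ᶜ},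
            (K : Set V) = D := by
          rintro K ⟨-, hK⟩
          obtain ⟨x, hx, hxD⟩ := Set.not_subset.mp hK
          exact (isComp_componentCompl K).eq ((h.connSet_of_mem_range D.2).isComp_of_nbhd hDY)
            ⟨x, hx, not_not.mp hxD⟩
        intro K hK K' hK'
        exact SetLike.coe_injective ((key K hK).trans (key K' hK').symm)
    · obtain ⟨C, hC⟩ := h.exists_parent_inr_eq Z
      rw [hC] at hp
      simp at hp
  · rw [h.sep_parent ht]
    refine ⟨Set.subset_union_right, (h.finite_comps_notMem_range Y).subset ?_⟩
    rintro K ⟨hK, hKsub⟩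
    exact ⟨hK, fun hKr => hKsub fun x hx => Or.inl ⟨K, hKr, hK, hx⟩⟩

/-- The edge from `t` towards `t'` would be oriented up and the edge above `t'` down, but the two
sides meet only in a finite adhesion set. -/
theorem ne_of_desc_of_livesAt {Y : crit G} {t t' : Node G X}
    (ht : h.decomposition.LivesAt (Sum.inr Y) t) (ht' : h.decomposition.LivesAt (Sum.inr Y) t')
    (hd : Desc h.parent t t') : t = t' := by
  by_contra hne
  obtain ⟨c, rfl, hca, hc⟩ := hd.exists_child hne
  have hcr : c ≠ h.root := by
    rintro rfl
    exact hca h.parent_root.symm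
  have htr : t' ≠ h.root := by
    rintro rfl
    exact hcr (h.isParentFun.eq_root_of_desc hc)
  have h1 := ht c (h.isParentFun.adj_parent hcr).symm
  have h2 := ht' _ (h.isParentFun.adj_parent htr)
  rw [h.sep_child hcr] at h1
  rw [h.sep_parent htr] at h2
  refine infinite_inter_of_orientsTowards h1 h2 ((h.adh_finite c).subset ?_)
  rintro x ⟨hx, hx'⟩
  exact (h.below_subset_of_desc hc hx').resolve_left hx

theorem livesAt_unique {Y : crit G} {t t' : Node G X}
    (ht : h.decomposition.LivesAt (Sum.inr Y) t) (ht' : h.decomposition.LivesAt (Sum.inr Y) t') :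
    t = t' := by
  by_cases hd : Desc h.parent t t'
  · exact h.ne_of_desc_of_livesAt ht ht' hd
  by_cases hd' : Desc h.parent t' t
  · exact (h.ne_of_desc_of_livesAt ht' ht hd').symm
  exfalso
  have htr : t ≠ h.root := by
    rintro rfl
    exact hd (h.isParentFun.desc_root t')
  have htr' : t' ≠ h.root := by
    rintro rfl
    exact hd' (h.isParentFun.desc_root t)
  have h1 := ht _ (h.isParentFun.adj_parent htr)
  have h2 := ht' _ (h.isParentFun.adj_parent htr')
  rw [h.sep_parent htr] at h1
  rw [h.sep_parent htr'] at h2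
  -- For incomparable nodes the cores are disjoint, so the sides below them meet only in the two
  -- adhesion sets.
  refine infinite_inter_of_orientsTowards h1 h2
    (((h.adh_finite t).union (h.adh_finite t')).subset ?_)
  rintro x ⟨hx | hx, hx' | hx'⟩
  · rcases (h.mem_core_iff.mp hx).total (h.mem_core_iff.mp hx') with hd'' | hd''
    · exact absurd hd'' hd
    · exact absurd hd'' hd'
  · exact Or.inr hx'
  · exact Or.inl hx
  · exact Or.inl hx

/-! ### The nodes of infinite degree -/

theorem finite_crit_children (C : Set.range (top G X)) :
    {Y : crit G | h.parent (Sum.inr Y) = Sum.inl C}.Finite := by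
  have hfin : (X C ∪ nbhd G (C : Set V)).Finite := h.bag_finite (Sum.inl C)
  refine Set.Finite.of_finite_image (f := Subtype.val) (hfin.finite_subsets.subset ?_)
    Subtype.val_injective.injOn
  rintro _ ⟨Y, hY, rfl⟩
  exact h.bag_subset_of_parent_inr hY

/-- Each branch child has a non-critical neighbourhood inside the finite part of `C`: there are
finitely many such sets, each the neighbourhood of finitely many components. -/
theorem finite_branch_children (C : Set.range (top G X)) :
    {D : Set.range (top G X) | h.parent (Sum.inl D) = Sum.inl C}.Finite := by
  have hfin : (X C ∪ nbhd G (C : Set V)).Finite := h.bag_finite (Sum.inl C)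
  have hsub : {D : Set.range (top G X) | h.parent (Sum.inl D) = Sum.inl C} ⊆
      ⋃ Z ∈ {Z | Z ⊆ X C ∪ nbhd G (C : Set V)},
        {D : Set.range (top G X) | nbhd G (D : Set V) = Z ∧ Z ∉ crit G} := by
    intro D hD
    have hsub : nbhd G (D : Set V) ⊆ X C ∪ nbhd G (C : Set V) := by
      have := h.adh_subset_bag_parent (Sum.inl D)
      rwa [show h.parent (Sum.inl D) = Sum.inl C from hD] at this
    refine Set.mem_biUnion hsub ⟨rfl, fun hN => ?_⟩
    have := (h.parent_inl_of_crit hN).symm.trans hD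
    simp at this
  refine (hfin.finite_subsets.biUnion fun Z hZ => ?_).subset hsub
  by_cases hZc : Z ∈ crit G
  · convert Set.finite_empty
    exact Set.eq_empty_of_forall_notMem fun D hD => hD.2 hZc
  · have hfinZ : (compsWithNbhd G Z Z).Finite := by
      by_contra hinf
      exact hZc ⟨hfin.subset hZ, hinf⟩
    refine Set.Finite.of_finite_image (f := Subtype.val)
      ((hfinZ.image fun K : G.ComponentCompl Z => (K : Set V)).subset ?_) Subtype.val_injective.injOn
    rintro _ ⟨D, ⟨hD, -⟩, rfl⟩
    obtain ⟨K, hK⟩ :=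
      ((h.connSet_of_mem_range D.2).isComp_of_nbhd hD).exists_componentCompl
    exact ⟨K, show nbhd G (K : Set V) = Z by rw [hK, hD], hK⟩

theorem finite_neighborSet_inl (C : Set.range (top G X)) :
    (h.decomposition.tree.neighborSet (Sum.inl C)).Finite := by
  refine ((((h.finite_crit_children C).image Sum.inr).union
    ((h.finite_branch_children C).image Sum.inl)).insert (h.parent (Sum.inl C))).subset ?_
  intro s hs
  rcases h.isParentFun.adj_cases hs with ⟨-, hp⟩ | ⟨-, hp⟩
  · exact Or.inl hp.symm
  · rcases s with D | Y
    · exact Or.inr (Or.inr ⟨D, hp, rfl⟩)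
    · exact Or.inr (Or.inl ⟨Y, hp, rfl⟩)

theorem adj_inr {D : Set.range (top G X)} {Y : crit G} (hDY : nbhd G (D : Set V) = Y) :
    h.decomposition.tree.Adj (Sum.inl D) (Sum.inr Y) :=
  ⟨by simp, Or.inl (h.parent_inl_eq_inr_iff.mpr hDY)⟩

theorem infinite_neighborSet_inr (Y : crit G) :
    (h.decomposition.tree.neighborSet (Sum.inr Y)).Infinite := by
  intro hfin
  -- The components that are branches give infinitely many children, told apart by their cores.
  have hinf := (Y.2.2.sdiff (h.finite_comps_notMem_range Y)).image
    (f := fun K : G.ComponentCompl (Y : Set V) => (K : Set V)) SetLike.coe_injective.injOn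
  refine hinf ((hfin.image core).subset ?_)
  rintro _ ⟨K, ⟨hK, hKr⟩, rfl⟩
  have hKr' : (K : Set V) ∈ Set.range (top G X) := by
    by_contra hcon
    exact hKr ⟨hK, hcon⟩
  exact ⟨Sum.inl ⟨K, hKr'⟩, (h.adj_inr (D := ⟨K, hKr'⟩) hK).symm, rfl⟩

theorem setOf_infinite_neighborSet :
    {t | (h.decomposition.tree.neighborSet t).Infinite} = Set.range Sum.inr := by
  ext t
  rcases t with C | Y
  · simpa using h.finite_neighborSet_inl C
  · simpa using h.infinite_neighborSet_inr Y

theorem bijOn_sep (Y : crit G) :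
    Set.BijOn (fun s => h.decomposition.sep s (Sum.inr Y))
      (h.decomposition.tree.neighborSet (Sum.inr Y))
      (insert (orientedSep (Y : Set V) (sepComps (Sum.inr Y : Node G X)))
        {P | ∃ C ∈ sepComps (Sum.inr Y : Node G X),
          P = (orientedSep (Y : Set V) {C}).swap}) := by
  have hpar := h.sep_parent_eq_orientedSep (h.inr_ne_root Y)
  have hchild : ∀ D : Set.range (top G X), h.parent (Sum.inl D) = Sum.inr Y →
      h.decomposition.sep (Sum.inl D) (Sum.inr Y) = ((D : Set V) ∪ Y, (D : Set V)ᶜ) := by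
    intro D hD
    have hDr : Sum.inl D ≠ h.root := fun hr => by
      rw [hr, h.parent_root] at hD
      exact h.inr_ne_root Y hD.symm
    have := h.sep_child hDr
    rw [hD] at this
    rw [this, ← h.parent_inl_eq_inr_iff.mp hD]
    rfl
  have hnb : ∀ s ∈ h.decomposition.tree.neighborSet (Sum.inr Y),
      s = h.parent (Sum.inr Y) ∨ ∃ D, s = Sum.inl D ∧ h.parent (Sum.inl D) = Sum.inr Y := by
    intro s hs
    rcases h.isParentFun.adj_cases hs with ⟨-, hp⟩ | ⟨-, hp⟩
    · exact Or.inl hp.symm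
    · rcases s with D | Z
      · exact Or.inr ⟨D, rfl, hp⟩
      · obtain ⟨C, hC⟩ := h.exists_parent_inr_eq Z
        rw [hC] at hp
        simp at hp
  have hsing : ∀ K : G.ComponentCompl (Y : Set V),
      (orientedSep (Y : Set V) {K}).swap = ((K : Set V) ∪ Y, (K : Set V)ᶜ) := by
    intro K
    simp [orientedSep, compsUnion, Set.union_comm]
  -- The side towards `Y` contains `D` for the edge from the parent but not for the edge from the
  -- child `D`.
  have hne : ∀ D : Set.range (top G X), h.parent (Sum.inl D) = Sum.inr Y →
      h.decomposition.sep (Sum.inl D) (Sum.inr Y) ≠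
        h.decomposition.sep (h.parent (Sum.inr Y)) (Sum.inr Y) := by
    intro D hD heq
    rw [hchild D hD, h.sep_parent (h.inr_ne_root Y)] at heq
    obtain ⟨x, hx⟩ := (h.connSet_of_mem_range D.2).1
    have hcore : x ∈ core (Sum.inr Y : Node G X) :=
      ⟨D, D.2, h.parent_inl_eq_inr_iff.mp hD, hx⟩
    have heq' : (D : Set V)ᶜ = _ := congrArg Prod.snd heq
    exact heq'.symm.subset (Or.inl hcore) hx
  refine ⟨?_, ?_, ?_⟩
  · intro s hs
    rcases hnb s hs with rfl | ⟨D, rfl, hD⟩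
    · exact Or.inl hpar
    · have hDY := h.parent_inl_eq_inr_iff.mp hD
      obtain ⟨K, hK⟩ :=
        ((h.connSet_of_mem_range D.2).isComp_of_nbhd hDY).exists_componentCompl
      refine Or.inr ⟨K, ⟨hK ▸ D.2, hK ▸ hDY, fun x hx => ⟨D, D.2, hDY, hK ▸ hx⟩⟩, ?_⟩
      exact (hchild D hD).trans (hK ▸ (hsing K).symm)
  · intro s hs s' hs' heq
    rcases hnb s hs with rfl | ⟨D, rfl, hD⟩ <;> rcases hnb s' hs' with rfl | ⟨D', rfl, hD'⟩
    · rfl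
    · exact absurd heq.symm (hne D' hD')
    · exact absurd heq (hne D hD)
    · simp only [hchild D hD, hchild D' hD', Prod.mk.injEq] at heq
      exact congrArg Sum.inl (Subtype.ext (compl_injective heq.2))
  · rintro _ (rfl | ⟨K, hK, rfl⟩)
    · exact ⟨_, (h.isParentFun.adj_parent (h.inr_ne_root Y)).symm, hpar⟩
    · refine ⟨Sum.inl ⟨K, hK.1⟩, (h.adj_inr hK.2.1).symm, ?_⟩
      exact (hchild ⟨K, hK.1⟩ (h.parent_inl_eq_inr_iff.mpr hK.2.1)).trans (hsing K).symm

theorem isPredecessor_parent {a : Node G X} (ha : a ≠ h.root) :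
    h.decomposition.IsPredecessor h.root (h.parent a) a :=
  ⟨h.isParentFun.adj_parent ha, fun q _ =>
    h.isParentFun.parent_mem_support q ha (.refl _ a)⟩

/-- With no ends on either side, the map sends each critical set to its own node, and those are the
nodes of infinite degree. -/
theorem decomposition_displays (hG : IsRayless G) (hT : IsRayless h.decomposition.tree) :
    h.decomposition.Displays h.root Set.univ := by
  have hG' := isEmpty_graphEnd hG
  have hT' := isEmpty_graphEnd hT
  refine ⟨Sum.elim (fun ω => hG'.elim ω) fun Y => Sum.inr (Sum.inr Y), ?_, ?_, ?_, ?_, ?_⟩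
  · rintro (ω | Y)
    · exact hG'.elim ω
    refine ⟨fun η => hT'.elim η, fun t => ?_⟩
    simp only [Sum.elim_inr, Sum.inr.injEq]
    exact ⟨fun ht => ht ▸ h.livesAt_inr Y, fun ht => h.livesAt_unique (h.livesAt_inr Y) ht⟩
  · refine ⟨?_, ?_, ?_⟩
    · rintro _ ⟨-, ω, rfl⟩
      exact hG'.elim ω
    · rintro _ ⟨-, ω, rfl⟩
      exact hG'.elim ω
    · rintro _ ⟨η, rfl⟩
      exact hT'.elim η
  · rw [h.setOf_infinite_neighborSet]
    refine ⟨?_, ?_, ?_⟩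
    · rintro _ ⟨-, Y, rfl⟩
      exact ⟨_, ⟨Y, rfl⟩, rfl⟩
    · rintro _ ⟨-, Y, rfl⟩ _ ⟨-, Z, rfl⟩ heq
      simp only [Sum.elim_inr, Sum.inr.injEq] at heq
      rw [heq]
    · rintro _ ⟨_, ⟨Y, rfl⟩, rfl⟩
      exact ⟨Sum.inr Y, ⟨trivial, Y, rfl⟩, rfl⟩
  · rintro Y t - ht
    simp only [Sum.elim_inr, Sum.inr.injEq] at ht
    subst ht
    refine ⟨h.parent (Sum.inr Y), sepComps (Sum.inr Y : Node G X),
      h.isPredecessor_parent (h.inr_ne_root Y), h.sep_parent_eq_orientedSep (h.inr_ne_root Y),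
      fun K hK => hK.2.1, (h.finite_comps_notMem_range Y).subset ?_, h.bijOn_sep Y⟩
    rintro K ⟨hK, hK'⟩
    exact ⟨hK, fun hKr => hK' ⟨hKr, hK, fun x hx => ⟨K, hKr, hK, hx⟩⟩⟩
  · exact fun γ hγ => absurd trivial hγ

/-! ### The rank of the decomposition tree -/

/-- Every proper descendant of a branch `C`, other than its critical children, is a descendant of
a branch that is a component of `C ∖ X C`. -/
theorem exists_branch_between {C : Set.range (top G X)} {b : Node G X}
    (hd : Desc h.parent (Sum.inl C) b) (hne : Sum.inl C ≠ b)
    (hb : ∀ Y, b = Sum.inr Y → h.parent b ≠ Sum.inl C) :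
    ∃ D : Set.range (top G X), IsComp G ((C : Set V) \ X C) D ∧ Desc h.parent (Sum.inl D) b ∧
      (h.parent (Sum.inl D) = Sum.inl C ∨ ∃ Y, h.parent (Sum.inl D) = Sum.inr Y ∧
        h.parent (Sum.inr Y) = Sum.inl C) := by
  have key : ∃ D : Set.range (top G X), Desc h.parent (Sum.inl D) b ∧ Sum.inl D ≠ h.root ∧
      (h.parent (Sum.inl D) = Sum.inl C ∨ ∃ Y, h.parent (Sum.inl D) = Sum.inr Y ∧
        h.parent (Sum.inr Y) = Sum.inl C) := by
    obtain ⟨c, hc, hcC, hcb⟩ := hd.exists_child hne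
    rcases c with D | Y
    · refine ⟨D, hcb, fun hr => ?_, Or.inl hc⟩
      rw [hr, h.parent_root] at hc
      exact hcC (hr.trans hc)
    · have hYb : Sum.inr Y ≠ b := fun he => hb Y he.symm (he ▸ hc)
      obtain ⟨c', hc', -, hcb'⟩ := hcb.exists_child hYb
      rcases c' with D | Z
      · refine ⟨D, hcb', fun hr => ?_, Or.inr ⟨Y, hc', hc⟩⟩
        rw [hr, h.parent_root] at hc'
        exact h.inr_ne_root Y hc'.symm
      · obtain ⟨E, hE⟩ := h.exists_parent_inr_eq Z
        rw [hE] at hc'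
        simp at hc'
  obtain ⟨D, hDb, hDr, hDC⟩ := key
  refine ⟨D, ?_, hDb, hDC⟩
  obtain hr | ⟨P, n, v, hv, hD, hP⟩ := h.eq_root_or D
  · exact absurd hr hDr
  have hPC : P = C := by
    rcases h.parent_cases hv hD hP with ⟨-, hp⟩ | ⟨Y, -, hp, hp'⟩
    · rcases hDC with hq | ⟨Z, hq, -⟩
      · exact Sum.inl_injective (hp.symm.trans hq)
      · exact absurd (hp.symm.trans hq) (by simp)
    · rcases hDC with hq | ⟨Z, hq, hq'⟩
      · exact absurd (hp.symm.trans hq) (by simp)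
      · obtain rfl := Sum.inr_injective (hp.symm.trans hq)
        exact Sum.inl_injective (hp'.symm.trans hq')
  rw [← hPC, hD, hP]
  exact isComp_branch hv

theorem rankLE_below (C : Set.range (top G X)) :
    RankLE (rk C) ((parentGraph h.parent).induce {b | Desc h.parent (Sum.inl C) b}) := by
  induction hρ : rk C using WellFoundedLT.induction generalizing C with
  | ind ρ ih =>
    subst hρ
    refine rankLE_induce_iff.mpr ⟨insert (Sum.inl C)
      (Sum.inr '' {Y : crit G | h.parent (Sum.inr Y) = Sum.inl C}),
      ((h.finite_crit_children C).image _).insert _, fun K hK => ?_⟩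
    obtain ⟨b, hb⟩ := hK.conn.1
    have hbetween := fun b hb => h.exists_branch_between (hK.sub (a := b) hb).1
      (fun he => (hK.sub hb).2 (Or.inl he.symm))
      (fun Y hY hp => (hK.sub hb).2 (Or.inr ⟨Y, show _ = _ from hY ▸ hp, hY.symm⟩))
    obtain ⟨D, hD, hDb, hDC⟩ := hbetween b hb
    have hlt := h.lt C (h.connSet_of_mem_range C.2) D hD
    refine ⟨rk D, hlt, (ih _ hlt D rfl).induce_mono ?_⟩
    -- The descendants of `D` can only be left through the parent of `D`, which is `C` or one of its
    -- critical children and thus deleted. So the component stays below `D`.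
    refine hK.conn.2 _ ⟨b, hb, hDb⟩ ?_
    intro x hx hxK y hy hxy
    rcases h.isParentFun.adj_cases hxy with ⟨-, hp⟩ | ⟨-, hp⟩
    · subst hp
      refine Desc.parent hx fun hxD => (hK.sub hy).2 ?_
      rw [hxD]
      rcases hDC with hq | ⟨Y, hq, hq'⟩
      · exact Or.inl hq
      · exact Or.inr ⟨Y, hq', hq.symm⟩
    · exact Desc.trans hx (hp ▸ desc_parent _ y)

theorem rankLE_tree : RankLE (rk Set.univ) h.decomposition.tree := by
  obtain ⟨v, -⟩ := h.conn.1
  have := h.rankLE_below ⟨Set.univ, h.branch_mem_range (n := 0) (v := v) trivial⟩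
  exact rankLE_induce_univ.mp (this.induce_mono fun a _ => h.isParentFun.desc_root a)

end IsCut

end Display

end InfGraph

theorem corollary3p12 {V : Type u} (G : SimpleGraph V) (hG : G.Connected) :
    (InfGraph.IsRayless G ↔ ∃ ρ : Ordinal.{u}, InfGraph.HasRank ρ G) ∧
    (InfGraph.IsRayless G →
      ∃ (W : Type u) (D : InfGraph.TreeDecomposition G W) (r : W),
        D.IsTame ∧
        (∀ t, (D.part t).Finite) ∧
        D.Displays r Set.univ ∧
        ∃ ρ : Ordinal.{u}, InfGraph.HasRank ρ G ∧ InfGraph.HasRank ρ D.tree) := by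
  refine ⟨⟨fun h => ?_, fun ⟨ρ, hρ⟩ => InfGraph.RankLE.isRayless ⟨ρ, le_rfl, hρ⟩⟩, fun hray => ?_⟩
  · obtain ⟨_, ρ, -, hρ⟩ := h.exists_rankLE hG
    exact ⟨ρ, hρ⟩
  obtain ⟨_, ρ, -, hρ⟩ := hray.exists_rankLE hG
  have hρ' : InfGraph.RankLE ρ G := ⟨ρ, le_rfl, hρ⟩
  obtain ⟨X, h⟩ := InfGraph.exists_isCut hG hρ'
  have hT : InfGraph.RankLE ρ h.decomposition.tree :=
    h.rankLE_tree.mono (InfGraph.setRank_le (InfGraph.rankLE_induce_univ.mpr hρ'))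
  refine ⟨_, h.decomposition, h.root, h.decomposition_isTame, h.bag_finite,
    h.decomposition_displays hray hT.isRayless, ρ, hρ, ?_⟩
  -- The tree has some rank `β ≤ ρ`. Finite parts give the graph a rank at most `β`, which is `ρ` by
  -- uniqueness.
  obtain ⟨β, hβ, hTβ⟩ := hT
  have hTβ' : InfGraph.RankLE β h.decomposition.tree := ⟨β, le_rfl, hTβ⟩
  obtain ⟨γ, hγ, hGγ⟩ := InfGraph.rankLE_induce_univ.mp <| InfGraph.RankLE.of_decomposition
    (G := G) InfGraph.bag h.bag_finite h.connSet_bag (fun _ _ hvw => h.exists_bag_of_adj hvw)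
    (fun v _ => Set.subset_univ _) (A := Set.univ) (InfGraph.rankLE_induce_univ.mpr hTβ')
  obtain rfl := hGγ.unique hρ
  rwa [le_antisymm hγ hβ]
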